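/- Let $d_0,d_1\ge 1$, let $\mu_0,\mu_1$ be compactly supported Borel probability measures on $\mathbb R^{d_0},\mathbb R^{d_1}$, and let $\varepsilon>0$. Equip $\mathbb R^{d_0\times d_1}$ with the Frobenius inner product and norm. For $A\in\mathbb R^{d_0\times d_1}$ put $c_A(x,y)=-4\|x\|^2\|y\|^2-32\,x^{\intercal}Ay$, $$\mathsf{OT}_{A,\varepsilon}=\inf_{\pi\in\Pi(\mu_0,\mu_1)}\int c_A\,d\pi+\varepsilon\,\mathsf D_{\mathsf{KL}}(\pi\,\|\,\mu_0\otimes\mu_1),\qquad \Phi(A)=32\|A\|_F^2+\mathsf{OT}_{A,\varepsilon},$$ where $\Pi(\mu_0,\mu_1)$ is the set of couplings, and let $M_4(\mu)=\int\|x\|^4\,d\mu(x)$. Then $\Phi$ is twice continuously differentiable, and for every $A\in\mathbb R^{d_0\times d_1}$ the following hold. There is a unique coupling $\pi_A$ attaining $\mathsf{OT}_{A,\varepsilon}$. There is a pair of continuous functions $(\varphi_0,\varphi_1)$ on $\mathbb R^{d_0}$ and $\mathbb R^{d_1}$ with $\int e^{(\varphi_0(x)+\varphi_1(y)-c_A(x,y))/\varepsilon}d\mu_1(y)=1$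 for all $x$ and $\int e^{(\varphi_0(x)+\varphi_1(y)-c_A(x,y))/\varepsilon}d\mu_0(x)=1$ for all $y$ (EOT potentials). For any such pair and every $C\in\mathbb R^{d_0\times d_1}$ there are functions $h_0^{A,C},h_1^{A,C}$, continuous on $\mathrm{spt}(\mu_0)$ and $\mathrm{spt}(\mu_1)$, with $$\int\big(h_0^{A,C}(x)+h_1^{A,C}(y)-32x^{\intercal}Cy\big)e^{\frac{\varphi_0(x)+\varphi_1(y)-c_A(x,y)}{\varepsilon}}d\mu_1(y)=0\quad\forall x\in\mathrm{spt}(\mu_0),$$ $$\int\big(h_0^{A,C}(x)+h_1^{A,C}(y)-32x^{\intercal}Cy\big)e^{\frac{\varphi_0(x)+\varphi_1(y)-c_A(x,y)}{\varepsilon}}d\mu_0(x)=0\quad\forall y\in\mathrm{spt}(\mu_1).$$ View the second Fréchet derivative $D^2\Phi_{[A]}$ as a $d_0d_1\times d_0d_1$ matrix. Then, for any choice of such $(\varphi_0,\varphi_1)$ and $(h_0^{A,C},h_1^{A,C})_C$: (i) The minimal eigenvalue satisfies $$\lambda_{\min}(D^2\Phi_{[A]})=64+\varepsilon^{-1}\inf_{\|C\|_F=1}\int\Big[\big(h_0^{A,C}(x)+h_1^{A,C}(y)\big)^2-32^2(x^{\intercal}Cy)^2\Big]d\pi_A(x,y)\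 \ge\ 64-32^2\varepsilon^{-1}\sup_{\|C\|_F=1}\mathrm{Var}_{\pi_A}(X^{\intercal}CY),$$ where $(X,Y)\sim\pi_A$, both the infimum and the supremum are finite, and $\sup_{\|C\|_F=1}\mathrm{Var}_{\pi_A}(X^{\intercal}CY)\le\sqrt{M_4(\mu_0)M_4(\mu_1)}$. (ii) The maximal eigenvalue satisfies $\lambda_{\max}(D^2\Phi_{[A]})\le 64$. -/

import Mathlib

open MeasureTheory

namespace EGW

/-- `ℝ^d` with the Euclidean norm. -/
abbrev E (d : ℕ) : Type := EuclideanSpace ℝ (Fin d)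

/-- The space `ℝ^{d₀ × d₁}` of real matrices `C`, with entries `C (i, j)`, the Frobenius inner
product `⟨B, C⟩ = ∑ᵢⱼ Bᵢⱼ Cᵢⱼ = Tr(Bᵀ C)` and the Frobenius norm `‖C‖`. -/
abbrev Mat (d₀ d₁ : ℕ) : Type := EuclideanSpace ℝ (Fin d₀ × Fin d₁)

noncomputable section

variable {d₀ d₁ : ℕ}

/-- The bilinear expression `xᵀ C y`. -/
def bil (C : Mat d₀ d₁) (x : E d₀) (y : E d₁) : ℝ :=
  ∑ i, ∑ j, x i * C (i, j) * y j

/-- The cost `c_A(x, y) = -4 ‖x‖² ‖y‖² - 32 xᵀ A y`. -/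
def cost (A : Mat d₀ d₁) (x : E d₀) (y : E d₁) : ℝ :=
  -4 * ‖x‖ ^ 2 * ‖y‖ ^ 2 - 32 * bil A x y

/-- `π` is a coupling of `μ₀` and `μ₁`, i.e. an element of `Π(μ₀, μ₁)`. -/
def IsCoupling (μ₀ : Measure (E d₀)) (μ₁ : Measure (E d₁)) (π : Measure (E d₀ × E d₁)) : Prop :=
  π.map Prod.fst = μ₀ ∧ π.map Prod.snd = μ₁

/-- The value `∫ c_A dπ + ε KL(π ‖ μ₀ ⊗ μ₁)`, which is `⊤` when the relative entropy is. -/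
def eotObjective (μ₀ : Measure (E d₀)) (μ₁ : Measure (E d₁)) (ε : ℝ) (A : Mat d₀ d₁)
    (π : Measure (E d₀ × E d₁)) : EReal :=
  ((∫ z, cost A z.1 z.2 ∂π : ℝ) : EReal) +
    ((ENNReal.ofReal ε * InformationTheory.klDiv π (μ₀.prod μ₁) : ENNReal) : EReal)

/-- The optimal value `OT_{A,ε}(μ₀, μ₁)` of the entropic optimal transport problem. -/
def OT (μ₀ : Measure (E d₀)) (μ₁ : Measure (E d₁)) (ε : ℝ) (A : Mat d₀ d₁) : ℝ :=
  (⨅ π ∈ {π | IsCoupling μ₀ μ₁ π}, eotObjective μ₀ μ₁ ε A π).toReal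

/-- `π` is an optimal coupling for `OT_{A,ε}(μ₀, μ₁)`. -/
def IsEOTCoupling (μ₀ : Measure (E d₀)) (μ₁ : Measure (E d₁)) (ε : ℝ) (A : Mat d₀ d₁)
    (π : Measure (E d₀ × E d₁)) : Prop :=
  IsCoupling μ₀ μ₁ π ∧
    ∀ π', IsCoupling μ₀ μ₁ π' → eotObjective μ₀ μ₁ ε A π ≤ eotObjective μ₀ μ₁ ε A π'

/-- The density `exp ((φ₀(x) + φ₁(y) - c_A(x, y)) / ε)`. -/
def gibbs (ε : ℝ) (A : Mat d₀ d₁) (φ₀ : E d₀ → ℝ) (φ₁ : E d₁ → ℝ) (x : E d₀) (y : E d₁) : ℝ :=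
  Real.exp ((φ₀ x + φ₁ y - cost A x y) / ε)

/-- `(φ₀, φ₁)` is a pair of EOT potentials for `OT_{A,ε}(μ₀, μ₁)`: continuous functions that
solve the Schrödinger system at all points. -/
structure IsEOTPotentials (μ₀ : Measure (E d₀)) (μ₁ : Measure (E d₁)) (ε : ℝ) (A : Mat d₀ d₁)
    (φ₀ : E d₀ → ℝ) (φ₁ : E d₁ → ℝ) : Prop where
  continuous_left : Continuous φ₀
  continuous_right : Continuous φ₁
  integral_left : ∀ x, ∫ y, gibbs ε A φ₀ φ₁ x y ∂μ₁ = 1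
  integral_right : ∀ y, ∫ x, gibbs ε A φ₀ φ₁ x y ∂μ₀ = 1

/-- `(h₀, h₁)`, continuous on the supports of `μ₀` and `μ₁`, solves the linearized Schrödinger
system in the direction `C`, where `(φ₀, φ₁)` are EOT potentials at `A`. -/
structure SolvesLinearized (μ₀ : Measure (E d₀)) (μ₁ : Measure (E d₁)) (ε : ℝ) (A : Mat d₀ d₁)
    (φ₀ : E d₀ → ℝ) (φ₁ : E d₁ → ℝ) (C : Mat d₀ d₁) (h₀ : E d₀ → ℝ) (h₁ : E d₁ → ℝ) : Prop where
  continuousOn_left : ContinuousOn h₀ μ₀.support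
  continuousOn_right : ContinuousOn h₁ μ₁.support
  integral_left : ∀ x ∈ μ₀.support,
    ∫ y, (h₀ x + h₁ y - 32 * bil C x y) * gibbs ε A φ₀ φ₁ x y ∂μ₁ = 0
  integral_right : ∀ y ∈ μ₁.support,
    ∫ x, (h₀ x + h₁ y - 32 * bil C x y) * gibbs ε A φ₀ φ₁ x y ∂μ₀ = 0

/-- The objective `Φ(A) = 32 ‖A‖_F² + OT_{A,ε}(μ₀, μ₁)`. -/
def Phi (μ₀ : Measure (E d₀)) (μ₁ : Measure (E d₁)) (ε : ℝ) (A : Mat d₀ d₁) : ℝ :=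
  32 * ‖A‖ ^ 2 + OT μ₀ μ₁ ε A

/-- The second Fréchet derivative `D²F_[A]` of a function of a matrix, written as a
`d₀d₁ × d₀d₁` matrix in the standard basis of matrix units. -/
def hessian (F : Mat d₀ d₁ → ℝ) (A : Mat d₀ d₁) :
    Matrix (Fin d₀ × Fin d₁) (Fin d₀ × Fin d₁) ℝ :=
  Matrix.of fun p q =>
    fderiv ℝ (fderiv ℝ F) A (EuclideanSpace.single p 1) (EuclideanSpace.single q 1)

/-- The set of real eigenvalues of a square matrix. -/
def eigenvalueSet {ι : Type} [Fintype ι] [DecidableEq ι] (H : Matrix ι ι ℝ) : Set ℝ :=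
  {l | Module.End.HasEigenvalue (Matrix.toLin' H) l}

/-- The `p`-th moment `M_p(μ) = ∫ ‖x‖^p dμ(x)`. -/
def moment {d : ℕ} (p : ℕ) (μ : Measure (E d)) : ℝ :=
  ∫ x, ‖x‖ ^ p ∂μ

end

end EGW

/-! Divide the potentials by ε and restrict them to the compact supports. EOT potentials become a
pair (u, v) of continuous functions for which the density g = exp(u + v + w), with w = -c_A/ε, has
both marginals equal to 1. Given such a pair, the objective on couplings is ∫φ₀ + ∫φ₁ plus ε times
the relative entropy to the Gibbs measure (`IsEOTPotentials.eotObjective_eq`). Hence the Gibbs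
measure is the only optimal coupling, and OT = ε(∫u + ∫v).

A pair (u, v) exists because a Sinkhorn sweep contracts oscillations (`log_mean_exp_contraction`,
`exists_isSol`). It can be chosen locally as a C² function of A by the implicit function theorem,
once a rank-one term has removed the invariance (u + c, v - c) (`exists_branch`). So OT is C².

Fix a direction C and put k = 32 xᵀCy/ε, S = (h₀ + h₁)/ε. The derivative of ∫u + ∫v is -∫kg, and
differentiating once more gives ∫g(S² - k²) (`fderiv_fderiv_meanAdd_branch`). The linearized system
says that S is the orthogonal projection of k, in L² with weight g, onto sums a(x) + b(y). Therefore
the value does not depend on the choice of h₀, h₁; it equals -∫g(S - k)² ≤ 0, which bounds the top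
eigenvalue by 64; and ∫gS² ≥ (∫gS)² = (∫gk)² bounds it below by minus the variance of k. The term
32‖A‖² contributes 64, and extremizing the quadratic form over the unit sphere gives the extreme
eigenvalues. -/

/-! ### Integration operators on spaces of continuous functions over compact spaces. -/

noncomputable section Operators

namespace EGW

variable {X Y Z : Type*} [TopologicalSpace X] [CompactSpace X] [TopologicalSpace Y] [CompactSpace Y]
  [TopologicalSpace Z] [CompactSpace Z]

/-- Precomposition with a continuous map, as a continuous linear map. -/
def pull (p : C(Z, X)) : C(X, ℝ) →L[ℝ] C(Z, ℝ) :=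
  LinearMap.mkContinuous
    { toFun := fun f => f.comp p
      map_add' := fun _ _ => rfl
      map_smul' := fun _ _ => rfl } 1 fun f => by
    rw [one_mul, ContinuousMap.norm_le _ (norm_nonneg f)]
    exact fun z => f.norm_coe_le_norm (p z)

@[simp] lemma pull_apply (p : C(Z, X)) (f : C(X, ℝ)) (z : Z) : pull p f z = f (p z) := rfl

@[simp] lemma exp_apply (f : C(X, ℝ)) (x : X) : NormedSpace.exp f x = Real.exp (f x) := by
  have h := NormedSpace.map_exp (ContinuousMap.evalAlgHom ℝ ℝ x)
    (continuous_eval_const x) f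
  rw [Real.exp_eq_exp_ℝ]
  exact h

lemma integrable_continuousMap [MeasurableSpace X] [OpensMeasurableSpace X]
    (μ : Measure X) [IsFiniteMeasure μ] (f : C(X, ℝ)) :
    Integrable f μ := by
  refine Integrable.of_bound (C := ‖f‖) ?_ (Filter.Eventually.of_forall f.norm_coe_le_norm)
  exact f.continuous.aestronglyMeasurable

/-- Integration of continuous functions against a probability measure. -/
def mean [MeasurableSpace X] [OpensMeasurableSpace X] (μ : Measure X)
    [IsProbabilityMeasure μ] : C(X, ℝ) →L[ℝ] ℝ :=
  LinearMap.mkContinuous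
    { toFun := fun f => ∫ x, f x ∂μ
      map_add' := fun f g => integral_add (integrable_continuousMap μ f)
        (integrable_continuousMap μ g)
      map_smul' := fun c f => integral_const_mul c _ } 1 fun f => by
    have h := norm_integral_le_of_norm_le_const (μ := μ) (f := f) (C := ‖f‖)
      (Filter.Eventually.of_forall f.norm_coe_le_norm)
    simpa using h

lemma mean_apply [MeasurableSpace X] [OpensMeasurableSpace X] (μ : Measure X)
    [IsProbabilityMeasure μ] (f : C(X, ℝ)) : mean μ f = ∫ x, f x ∂μ := rfl

lemma mean_nonneg [MeasurableSpace X] [OpensMeasurableSpace X] (μ : Measure X)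
    [IsProbabilityMeasure μ] {f : C(X, ℝ)} (h : ∀ x, 0 ≤ f x) : 0 ≤ mean μ f :=
  integral_nonneg h

@[simp] lemma mean_one [MeasurableSpace X] [OpensMeasurableSpace X] (μ : Measure X)
    [IsProbabilityMeasure μ] : mean μ (1 : C(X, ℝ)) = 1 := by
  simp [mean_apply]

/-- Integration over the second variable. -/
def pintL [MeasurableSpace Y] [OpensMeasurableSpace Y] (ν : Measure Y) [IsProbabilityMeasure ν] :
    C(X × Y, ℝ) →L[ℝ] C(X, ℝ) :=
  LinearMap.mkContinuous
    { toFun := fun f => ⟨fun x => mean ν (f.curry x), (mean ν).continuous.comp f.curry.continuous⟩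
      map_add' := fun f g => by ext x; exact map_add (mean ν) (f.curry x) (g.curry x)
      map_smul' := fun c f => by ext x; exact map_smul (mean ν) c (f.curry x) } 1 fun f => by
    rw [one_mul, ContinuousMap.norm_le _ (norm_nonneg f)]
    intro x
    have h := norm_integral_le_of_norm_le_const (μ := ν) (f := fun y => f (x, y)) (C := ‖f‖)
      (Filter.Eventually.of_forall fun y => f.norm_coe_le_norm (x, y))
    simpa [mean_apply] using h

lemma pintL_apply [MeasurableSpace Y] [OpensMeasurableSpace Y] (ν : Measure Y)
    [IsProbabilityMeasure ν] (f : C(X × Y, ℝ)) (x : X) :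
    pintL ν f x = ∫ y, f (x, y) ∂ν := rfl

/-- Integration over the first variable. -/
def pintR [MeasurableSpace X] [OpensMeasurableSpace X] (μ : Measure X) [IsProbabilityMeasure μ] :
    C(X × Y, ℝ) →L[ℝ] C(Y, ℝ) :=
  (pintL μ).comp (pull (ContinuousMap.prodSwap))

lemma pintR_apply [MeasurableSpace X] [OpensMeasurableSpace X] (μ : Measure X)
    [IsProbabilityMeasure μ] (f : C(X × Y, ℝ)) (y : Y) :
    pintR μ f y = ∫ x, f (x, y) ∂μ := rfl

/-- A function of the first variable, as a function of both. -/
abbrev liftL : C(X, ℝ) →L[ℝ] C(X × Y, ℝ) := pull ContinuousMap.fst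

/-- A function of the second variable, as a function of both. -/
abbrev liftR : C(Y, ℝ) →L[ℝ] C(X × Y, ℝ) := pull ContinuousMap.snd

/-- The function `exp (u(x) + v(y) + w(x, y))`. -/
def density (w : C(X × Y, ℝ)) (u : C(X, ℝ)) (v : C(Y, ℝ)) : C(X × Y, ℝ) :=
  NormedSpace.exp (liftL u + liftR v + w)

lemma density_apply (w : C(X × Y, ℝ)) (u : C(X, ℝ)) (v : C(Y, ℝ)) (z : X × Y) :
    density w u v z = Real.exp (u z.1 + v z.2 + w z) := by
  simp [density]

lemma density_pos (w : C(X × Y, ℝ)) (u : C(X, ℝ)) (v : C(Y, ℝ)) (z : X × Y) :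
    0 < density w u v z := by
  rw [density_apply]; exact Real.exp_pos _

lemma pintL_mul_liftL [MeasurableSpace Y] [OpensMeasurableSpace Y] (ν : Measure Y)
    [IsProbabilityMeasure ν] (f : C(X × Y, ℝ)) (a : C(X, ℝ)) :
    pintL ν (f * liftL a) = pintL ν f * a := by
  ext x
  simp [pintL_apply, integral_mul_const]

lemma pintR_mul_liftR [MeasurableSpace X] [OpensMeasurableSpace X] (μ : Measure X)
    [IsProbabilityMeasure μ] (f : C(X × Y, ℝ)) (b : C(Y, ℝ)) :
    pintR μ (f * liftR b) = pintR μ f * b := by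
  ext x
  simp [pintR_apply, integral_mul_const]

variable [MeasurableSpace X] [BorelSpace X] [SecondCountableTopology X]
  [MeasurableSpace Y] [BorelSpace Y] [SecondCountableTopology Y]
  (μ : Measure X) [IsProbabilityMeasure μ] (ν : Measure Y) [IsProbabilityMeasure ν]

lemma mean_pintL (f : C(X × Y, ℝ)) : mean μ (pintL ν f) = mean (μ.prod ν) f :=
  (integral_prod _ (integrable_continuousMap _ f)).symm

lemma mean_pintR (f : C(X × Y, ℝ)) : mean ν (pintR μ f) = mean (μ.prod ν) f :=
  (integral_prod_symm _ (integrable_continuousMap _ f)).symm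

/-- `(u, v)` solves the Schrödinger system with log-kernel `w`. -/
structure IsSol (w : C(X × Y, ℝ)) (u : C(X, ℝ)) (v : C(Y, ℝ)) : Prop where
  left : pintL ν (density w u v) = 1
  right : pintR μ (density w u v) = 1

end EGW

end Operators

/-! ### Existence of solutions of the Schrödinger system by Sinkhorn contraction. -/

noncomputable section Sinkhorn

namespace EGW

variable {X Y : Type*} [TopologicalSpace X] [TopologicalSpace Y] [CompactSpace Y]

section LogPartition

variable [MeasurableSpace Y] [OpensMeasurableSpace Y] (ν : Measure Y) [IsProbabilityMeasure ν]

lemma mean_mono {f g : C(Y, ℝ)} (h : ∀ y, f y ≤ g y) : mean ν f ≤ mean ν g := by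
  have := mean_nonneg ν (f := g - f) fun y => sub_nonneg.2 (h y)
  rwa [map_sub, sub_nonneg] at this

lemma mean_exp_pos (f : C(Y, ℝ)) : 0 < mean ν (NormedSpace.exp f) := by
  have h := mean_mono ν (f := Real.exp (-‖f‖) • 1) (g := NormedSpace.exp f) fun y => by
    simpa using neg_le_of_abs_le (f.norm_coe_le_norm y)
  rw [map_smul, mean_one] at h
  exact lt_of_lt_of_le (by simpa using Real.exp_pos _) h

/-- Each difference of logarithms is the log of an average of exp(v - v'), with weights proportional
to exp(v' + k) or exp(v' + k'). These normalized weights are comparable up to the factor δ =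
exp(-4B), so the excess of the average over the minimum of exp(v - v') survives up to δ when k is
replaced by k'. Concavity of log carries this over to the logarithms. -/
lemma log_mean_exp_contraction [Nonempty Y] {B M : ℝ} {k k' v v' : C(Y, ℝ)}
    (hk : ∀ y, |k y| ≤ B) (hk' : ∀ y, |k' y| ≤ B)
    (hM : ∀ y y', (v y - v' y) - (v y' - v' y') ≤ M) :
    (Real.log (mean ν (NormedSpace.exp (v + k))) - Real.log (mean ν (NormedSpace.exp (v' + k)))) -
      (Real.log (mean ν (NormedSpace.exp (v + k'))) -
        Real.log (mean ν (NormedSpace.exp (v' + k')))) ≤ (1 - Real.exp (-4 * B)) * M := by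
  obtain ⟨y₀, hy₀⟩ : ∃ y₀, ∀ y, (v - v') y₀ ≤ (v - v') y := by
    obtain ⟨y₀, -, h⟩ := isCompact_univ.exists_isMinOn Set.univ_nonempty
      (v - v').continuous.continuousOn
    exact ⟨y₀, fun y => h (Set.mem_univ y)⟩
  set m := (v - v') y₀ with hm
  have hB : 0 ≤ B := (abs_nonneg _).trans (hk y₀)
  have hlow : ∀ y, m + v' y ≤ v y := fun y => by
    have := hy₀ y
    simp only [ContinuousMap.sub_apply] at this hm
    linarith
  have hup : ∀ y, v y ≤ m + M + v' y := fun y => by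
    have := hM y y₀
    simp only [ContinuousMap.sub_apply] at hm
    linarith
  have hF := mean_exp_pos ν (v + k)
  have hG := mean_exp_pos ν (v' + k)
  have hF' := mean_exp_pos ν (v + k')
  have hG' := mean_exp_pos ν (v' + k')
  set F := mean ν (NormedSpace.exp (v + k)) with hFd
  set G := mean ν (NormedSpace.exp (v' + k)) with hGd
  set F' := mean ν (NormedSpace.exp (v + k')) with hFd'
  set G' := mean ν (NormedSpace.exp (v' + k')) with hGd'
  have h1 : Real.exp m * G ≤ F := by
    rw [hGd, ← smul_eq_mul, ← map_smul]
    refine mean_mono ν fun y => ?_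
    simp only [ContinuousMap.smul_apply, exp_apply, ContinuousMap.add_apply, smul_eq_mul,
      ← Real.exp_add, Real.exp_le_exp]
    linarith [hlow y]
  have h2 : F ≤ Real.exp (m + M) * G := by
    rw [hGd, ← smul_eq_mul, ← map_smul]
    refine mean_mono ν fun y => ?_
    simp only [ContinuousMap.smul_apply, exp_apply, ContinuousMap.add_apply, smul_eq_mul,
      ← Real.exp_add, Real.exp_le_exp]
    linarith [hup y]
  have h3 : G' ≤ Real.exp (2 * B) * G := by
    rw [hGd, ← smul_eq_mul, ← map_smul]
    refine mean_mono ν fun y => ?_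
    simp only [ContinuousMap.smul_apply, exp_apply, ContinuousMap.add_apply, smul_eq_mul,
      ← Real.exp_add, Real.exp_le_exp]
    linarith [(abs_le.1 (hk y)).1, (abs_le.1 (hk' y)).2]
  have h4 : Real.exp (-2 * B) * (F - Real.exp m * G) ≤ F' - Real.exp m * G' := by
    simp only [hFd, hGd, hFd', hGd', ← smul_eq_mul, ← map_smul, ← map_sub]
    refine mean_mono ν fun y => ?_
    simp only [ContinuousMap.smul_apply, exp_apply, ContinuousMap.add_apply, smul_eq_mul,
      ContinuousMap.sub_apply]
    have e1 : Real.exp (-2 * B) * Real.exp (k y) ≤ Real.exp (k' y) := by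
      rw [← Real.exp_add, Real.exp_le_exp]
      linarith [(abs_le.1 (hk y)).2, (abs_le.1 (hk' y)).1]
    have e2 : Real.exp m * Real.exp (v' y) ≤ Real.exp (v y) := by
      rw [← Real.exp_add, Real.exp_le_exp]; exact hlow y
    simp only [Real.exp_add]
    nlinarith [mul_nonneg (sub_nonneg.2 e1) (sub_nonneg.2 e2)]
  set δ := Real.exp (-4 * B) with hδ
  have hδ0 : 0 < δ := Real.exp_pos _
  have hδ1 : δ ≤ 1 := Real.exp_le_one_iff.2 (by linarith)
  -- The 4B splits in two: one factor exp(-2B) is lost in the numerator (`h4`) and one in the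
  -- normalization (`h3`).
  have h5 : δ * (F / G) + (1 - δ) * Real.exp m ≤ F' / G' := by
    rw [le_div_iff₀ hG']
    have e0 : Real.exp (-2 * B) = δ * Real.exp (2 * B) := by
      rw [hδ, ← Real.exp_add]; ring_nf
    have e1 : 0 ≤ F / G - Real.exp m := by
      rw [sub_nonneg, le_div_iff₀ hG]; exact h1
    have e2 : F - Real.exp m * G = (F / G - Real.exp m) * G := by
      field_simp
    rw [e2, e0] at h4
    have e3 := mul_le_mul_of_nonneg_left h3 (mul_nonneg hδ0.le e1)
    nlinarith
  have h6 : δ * Real.log (F / G) + (1 - δ) * m ≤ Real.log (F' / G') := by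
    have hc := strictConcaveOn_log_Ioi.concaveOn.2 (x := F / G) (y := Real.exp m)
      (Set.mem_Ioi.2 (div_pos hF hG)) (Set.mem_Ioi.2 (Real.exp_pos m)) hδ0.le
      (sub_nonneg.2 hδ1) (by ring)
    simp only [smul_eq_mul, Real.log_exp] at hc
    refine hc.trans (Real.log_le_log ?_ h5)
    have := mul_pos hδ0 (div_pos hF hG)
    have := mul_nonneg (sub_nonneg.2 hδ1) (Real.exp_pos m).le
    linarith
  have h7 : Real.log (F / G) ≤ m + M := by
    rw [Real.log_le_iff_le_exp (div_pos hF hG), div_le_iff₀ hG]; exact h2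
  rw [Real.log_div hF.ne' hG.ne'] at h6 h7
  rw [Real.log_div hF'.ne' hG'.ne'] at h6
  nlinarith [mul_le_mul_of_nonneg_left h7 (sub_nonneg.2 hδ1)]

/-- The negative log-partition function `x ↦ -log ∫ exp (v(y) + w(x, y)) dν(y)`. -/
def softTransform (w : C(X × Y, ℝ)) (v : C(Y, ℝ)) : C(X, ℝ) :=
  ⟨fun x => -Real.log (mean ν (NormedSpace.exp (v + w.curry x))), by
    refine Continuous.neg (Continuous.log ?_ fun x => (mean_exp_pos ν _).ne')
    refine (mean ν).continuous.comp ?_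
    refine (NormedSpace.exp_continuous).comp ?_
    exact continuous_const.add w.curry.continuous⟩

lemma softTransform_apply (w : C(X × Y, ℝ)) (v : C(Y, ℝ)) (x : X) :
    softTransform ν w v x = -Real.log (mean ν (NormedSpace.exp (v + w.curry x))) := rfl

lemma softTransform_contraction [Nonempty Y] {w : C(X × Y, ℝ)} {B M : ℝ}
    (hw : ∀ z, |w z| ≤ B) {v v' : C(Y, ℝ)}
    (hM : ∀ y y', (v y - v' y) - (v y' - v' y') ≤ M) (x x' : X) :
    (softTransform ν w v x - softTransform ν w v' x) -
      (softTransform ν w v x' - softTransform ν w v' x') ≤ (1 - Real.exp (-4 * B)) * M := by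
  have := log_mean_exp_contraction ν (k := w.curry x') (k' := w.curry x) (fun y => hw (x', y))
    (fun y => hw (x, y)) hM
  simp only [softTransform_apply]
  linarith

lemma pintL_density_softTransform [CompactSpace X] (w : C(X × Y, ℝ)) (v : C(Y, ℝ)) :
    pintL ν (density w (softTransform ν w v) v) = 1 := by
  ext x
  have h : ∀ y, density w (softTransform ν w v) v (x, y) =
      Real.exp (softTransform ν w v x) * NormedSpace.exp (v + w.curry x) y := fun y => by
    rw [density_apply, exp_apply, ← Real.exp_add]
    simp [add_assoc]
  rw [pintL_apply]
  simp only [h]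
  rw [integral_const_mul, ← mean_apply, softTransform_apply, Real.exp_neg,
    Real.exp_log (mean_exp_pos ν _), inv_mul_cancel₀ (mean_exp_pos ν _).ne']
  rfl

end LogPartition

variable [CompactSpace X] [MeasurableSpace X] [BorelSpace X] [MeasurableSpace Y] [BorelSpace Y]
  (μ : Measure X) [IsProbabilityMeasure μ] (ν : Measure Y) [IsProbabilityMeasure ν]

/-- One sweep of the Sinkhorn algorithm, normalized to vanish at `y₀`. -/
def sinkhorn (w : C(X × Y, ℝ)) (y₀ : Y) (v : C(Y, ℝ)) : C(Y, ℝ) :=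
  let s := softTransform μ (w.comp ContinuousMap.prodSwap) (softTransform ν w v)
  s - s y₀ • 1

/-- A sweep is two soft transforms, hence the square; the normalization at `y₀` subtracts a constant
and leaves oscillations unchanged. -/
lemma sinkhorn_iterate_contraction [Nonempty X] {w : C(X × Y, ℝ)} {B M : ℝ}
    (hw : ∀ z, |w z| ≤ B) (y₀ : Y) {v v' : C(Y, ℝ)}
    (hM : ∀ y y', (v y - v' y) - (v y' - v' y') ≤ M) (j : ℕ) (y y' : Y) :
    ((sinkhorn μ ν w y₀)^[j] v y - (sinkhorn μ ν w y₀)^[j] v' y) -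
      ((sinkhorn μ ν w y₀)^[j] v y' - (sinkhorn μ ν w y₀)^[j] v' y') ≤
      ((1 - Real.exp (-4 * B)) ^ 2) ^ j * M := by
  induction j generalizing y y' with
  | zero => simpa using hM y y'
  | succ j ih =>
    have : Nonempty Y := ⟨y₀⟩
    have h := softTransform_contraction μ (w := w.comp ContinuousMap.prodSwap)
      (fun z => hw z.swap) (softTransform_contraction ν hw ih) y y'
    simp only [Function.iterate_succ_apply', sinkhorn, ContinuousMap.sub_apply,
      ContinuousMap.smul_apply, ContinuousMap.one_apply, smul_eq_mul, mul_one]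
    rw [pow_succ' _ j]
    linarith

lemma exists_sinkhorn_fixedPoint [Nonempty X] (w : C(X × Y, ℝ)) (y₀ : Y) :
    ∃ v, sinkhorn μ ν w y₀ v = v := by
  set B := ‖w‖ + 1
  set q := (1 - Real.exp (-4 * B)) ^ 2 with hq
  have hB : 0 < B := by positivity
  have hq0 : 0 ≤ q := sq_nonneg _
  have hq1 : q < 1 := by
    have h1 : Real.exp (-4 * B) < 1 := by
      rw [Real.exp_lt_one_iff]; linarith
    have h2 := Real.exp_pos (-4 * B)
    rw [hq]; nlinarith
  obtain ⟨j, hj⟩ : ∃ j : ℕ, q ^ j < 1 / 2 := exists_pow_lt_of_lt_one (by norm_num) hq1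
  -- The factor 2 bounds an oscillation by a sup distance. The exponent j + 1 guarantees at least
  -- one sweep, so that the iterates vanish at `y₀`.
  have hj' : q ^ (j + 1) * 2 < 1 := by
    have : q ^ (j + 1) ≤ q ^ j := pow_le_pow_of_le_one hq0 hq1.le (Nat.le_succ j)
    linarith
  set f := sinkhorn μ ν w y₀ with hf
  have hf0 : ∀ v, f v y₀ = 0 := fun v => by simp [hf, sinkhorn]
  have hc : ContractingWith (Real.toNNReal (q ^ (j + 1) * 2)) (f^[j + 1]) := by
    refine ⟨by rw [Real.toNNReal_lt_one]; exact hj', LipschitzWith.of_dist_le_mul fun v v' => ?_⟩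
    rw [Real.coe_toNNReal _ (by positivity),
      ContinuousMap.dist_le (by positivity)]
    have hM : ∀ y y', (v y - v' y) - (v y' - v' y') ≤ 2 * dist v v' := fun y y' => by
      have h1 := abs_le.1 ((Real.dist_eq _ _).symm.trans_le (ContinuousMap.dist_apply_le_dist y
        (f := v) (g := v')))
      have h2 := abs_le.1 ((Real.dist_eq _ _).symm.trans_le (ContinuousMap.dist_apply_le_dist y'
        (f := v) (g := v')))
      linarith [h1.2, h2.1]
    have hw : ∀ z, |w z| ≤ B := fun z => (w.norm_coe_le_norm z).trans (by simp [B])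
    intro y
    -- As both iterates vanish at `y₀`, comparison with `y₀` turns the oscillation bound back into a
    -- sup bound.
    have e1 := sinkhorn_iterate_contraction μ ν hw y₀ hM (j + 1) y y₀
    have e2 := sinkhorn_iterate_contraction μ ν hw y₀ hM (j + 1) y₀ y
    have z1 : f^[j + 1] v y₀ = 0 := by rw [Function.iterate_succ_apply']; exact hf0 _
    have z2 : f^[j + 1] v' y₀ = 0 := by rw [Function.iterate_succ_apply']; exact hf0 _
    rw [← hf, z1, z2] at e1 e2
    rw [Real.dist_eq, abs_le]
    constructor <;> linarith
  -- The unique fixed point of an iterate of `f` is fixed by `f` itself.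
  exact ⟨_, hc.isFixedPt_fixedPoint_iterate⟩

theorem exists_isSol [SecondCountableTopology X] [SecondCountableTopology Y] (w : C(X × Y, ℝ)) : ∃ u v, IsSol μ ν w u v := by
  obtain ⟨x₀⟩ := μ.nonempty_of_neZero
  obtain ⟨y₀⟩ := ν.nonempty_of_neZero
  have : Nonempty X := ⟨x₀⟩
  obtain ⟨v, hv⟩ := exists_sinkhorn_fixedPoint μ ν w y₀
  set u := softTransform ν w v
  set s := softTransform μ (w.comp ContinuousMap.prodSwap) u with hs
  have hv' : s - s y₀ • 1 = v := hv
  have h1 : pintL ν (density w u v) = 1 := pintL_density_softTransform ν w v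
  have h2 : pintR μ (density w u s) = 1 := by
    rw [← pintL_density_softTransform μ (w.comp ContinuousMap.prodSwap) u]
    refine congrArg (pintL μ) ?_
    ext z
    simp [density_apply, hs, add_comm]
  have h3 : pintR μ (density w u v) = Real.exp (-s y₀) • 1 := by
    rw [← h2, ← map_smul]
    congr 1
    ext z
    simp only [← hv', density_apply, ContinuousMap.smul_apply, smul_eq_mul, ← Real.exp_add,
      ContinuousMap.sub_apply, ContinuousMap.one_apply]
    ring_nf
  -- A fixed point of the normalized sweep solves the second equation only up to a constant factor;
  -- computing the total mass in both orders shows that this factor is 1.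
  have h4 : Real.exp (-s y₀) = 1 := by
    have e := (mean_pintL μ ν (density w u v)).trans (mean_pintR μ ν (density w u v)).symm
    rw [h1, h3, map_smul, mean_one, mean_one] at e
    simpa using e.symm
  exact ⟨u, v, h1, by rw [h3, h4, one_smul]⟩

end EGW

end Sinkhorn

/-! ### Smooth branches of solutions and the second derivative of their mean. -/

noncomputable section Branch

namespace EGW

open Filter Topology

/-- Eliminating the first coordinate leaves the Schur complement 1 - TB, which a Neumann series
inverts. -/
lemma isInvertible_block {U V : Type*} [NormedAddCommGroup U] [NormedSpace ℝ U]
    [NormedAddCommGroup V] [NormedSpace ℝ V] [CompleteSpace V] {B : V →L[ℝ] U} {T : U →L[ℝ] V}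
    (h : ‖T‖ * ‖B‖ < 1) {D : U × V →L[ℝ] U × V} (hD : ∀ z, D z = (z.1 + B z.2, z.2 + T z.1)) :
    D.IsInvertible := by
  obtain ⟨r, hr⟩ := isUnit_one_sub_of_norm_lt_one ((T.opNorm_comp_le B).trans_lt h)
  have h1 : ∀ v, r.inv v - T (B (r.inv v)) = v := fun v => by
    have := DFunLike.congr_fun r.mul_inv v
    rw [hr] at this
    exact this
  have h2 : ∀ v, r.inv (v - T (B v)) = v := fun v => by
    have := DFunLike.congr_fun r.inv_mul v
    rw [hr] at this
    exact this
  let R : U × V →L[ℝ] V :=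
    (r.inv : V →L[ℝ] V).comp (ContinuousLinearMap.snd ℝ U V - T.comp (ContinuousLinearMap.fst ℝ U V))
  have hR : ∀ z, R z = r.inv (z.2 - T z.1) := fun z => rfl
  refine ContinuousLinearMap.IsInvertible.of_inverse
    (g := (ContinuousLinearMap.fst ℝ U V - B.comp R).prod R) ?_ ?_
  · refine ContinuousLinearMap.ext fun z => ?_
    have := h1 (z.2 - T z.1)
    rw [← hR] at this
    refine (hD _).trans (Prod.ext ?_ ?_)
    · exact sub_add_cancel z.1 (B (R z))
    · change R z + T (z.1 - B (R z)) = z.2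
      rw [map_sub, add_sub_left_comm, this]
      abel
  · refine ContinuousLinearMap.ext fun z => ?_
    have e : R (D z) = z.2 := by
      rw [hR, hD]
      simp only [map_add]
      convert h2 z.2 using 2
      abel
    refine Prod.ext ?_ e
    change (D z).1 - B (R (D z)) = z.1
    rw [e, hD, add_sub_cancel_right]

variable {X Y : Type*} [TopologicalSpace X] [CompactSpace X] [TopologicalSpace Y] [CompactSpace Y]
  {P : Type*} [NormedAddCommGroup P] [NormedSpace ℝ P]

/-- The linear part of `(A, u, v) ↦ u(x) + v(y) + (k + κ A)(x, y)`. -/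
def logLin (κ : P →L[ℝ] C(X × Y, ℝ)) : P × (C(X, ℝ) × C(Y, ℝ)) →L[ℝ] C(X × Y, ℝ) :=
  κ.coprod (liftL.coprod liftR)

/-- The density as a function of the parameter and of the potentials. -/
def paramDensity (k : C(X × Y, ℝ)) (κ : P →L[ℝ] C(X × Y, ℝ))
    (z : P × (C(X, ℝ) × C(Y, ℝ))) : C(X × Y, ℝ) :=
  density (k + κ z.1) z.2.1 z.2.2

lemma paramDensity_eq (k : C(X × Y, ℝ)) (κ : P →L[ℝ] C(X × Y, ℝ)) :
    paramDensity k κ = fun z => NormedSpace.exp (logLin κ z + k) := by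
  funext z
  rw [paramDensity, density]
  congr 1
  rw [show logLin κ z = κ z.1 + (liftL z.2.1 + liftR z.2.2) from rfl]
  abel

lemma contDiff_paramDensity (k : C(X × Y, ℝ)) (κ : P →L[ℝ] C(X × Y, ℝ)) :
    ContDiff ℝ 2 (paramDensity k κ) := by
  rw [paramDensity_eq]
  have h : ContDiff ℝ 2 (NormedSpace.exp : C(X × Y, ℝ) → C(X × Y, ℝ)) :=
    contDiff_iff_contDiffAt.2 fun f => (NormedSpace.exp_analytic (𝕂 := ℝ) f).contDiffAt
  exact h.comp ((logLin κ).contDiff.add contDiff_const)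

lemma hasFDerivAt_paramDensity (k : C(X × Y, ℝ)) (κ : P →L[ℝ] C(X × Y, ℝ))
    (z : P × (C(X, ℝ) × C(Y, ℝ))) :
    HasFDerivAt (paramDensity k κ)
      ((ContinuousLinearMap.mul ℝ _ (paramDensity k κ z)).comp (logLin κ)) z := by
  have h := (hasFDerivAt_exp (𝕂 := ℝ) (x := logLin κ z + k)).comp z
    ((logLin κ).hasFDerivAt.add_const k)
  rw [paramDensity_eq]
  exact h

variable [MeasurableSpace X] [BorelSpace X] [MeasurableSpace Y] [BorelSpace Y]
  (μ : Measure X) [IsProbabilityMeasure μ] (ν : Measure Y) [IsProbabilityMeasure ν]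

/-- The sum of the means of a pair of functions. -/
def meanAdd : C(X, ℝ) × C(Y, ℝ) →L[ℝ] ℝ := (mean μ).coprod (mean ν)

lemma meanAdd_apply (z : C(X, ℝ) × C(Y, ℝ)) : meanAdd μ ν z = mean μ z.1 + mean ν z.2 := rfl

/-- `(a, b)` solves the linearized system with right-hand side `k` and density `g`. -/
structure IsLinSol (g k : C(X × Y, ℝ)) (a : C(X, ℝ)) (b : C(Y, ℝ)) : Prop where
  left : pintL ν (g * (liftL a + liftR b - k)) = 0
  right : pintR μ (g * (liftL a + liftR b - k)) = 0

/-- The derivative of a differentiable family of solutions solves the linearized system. -/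
lemma isLinSol_of_branch {k : C(X × Y, ℝ)} {κ : P →L[ℝ] C(X × Y, ℝ)} {A : P}
    {Ψ : P → C(X, ℝ) × C(Y, ℝ)} (hd : DifferentiableAt ℝ Ψ A)
    (hsol : ∀ᶠ A' in 𝓝 A, IsSol μ ν (k + κ A') (Ψ A').1 (Ψ A').2) (C : P) :
    IsLinSol μ ν (density (k + κ A) (Ψ A).1 (Ψ A).2) (κ C) (-(fderiv ℝ Ψ A C).1)
      (-(fderiv ℝ Ψ A C).2) := by
  have hG := HasFDerivAt.comp (f := fun A' => (A', Ψ A')) A (hasFDerivAt_paramDensity k κ (A, Ψ A))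
      ((hasFDerivAt_id A).prodMk hd.hasFDerivAt)
  have e : ∀ g : C(X × Y, ℝ), g * (liftL (-(fderiv ℝ Ψ A C).1) + liftR (-(fderiv ℝ Ψ A C).2) -
      κ C) = -(g * logLin κ (C, fderiv ℝ Ψ A C)) := fun g => by
    rw [show logLin κ (C, fderiv ℝ Ψ A C) = κ C + (liftL (fderiv ℝ Ψ A C).1 +
      liftR (fderiv ℝ Ψ A C).2) from rfl, map_neg, map_neg]
    ring
  constructor
  · rw [e, map_neg, neg_eq_zero]
    have h1 := (pintL ν).hasFDerivAt.comp A hG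
    have h2 : HasFDerivAt (fun A' => pintL ν (paramDensity k κ (A', Ψ A')))
        (0 : P →L[ℝ] C(X, ℝ)) A :=
      (hasFDerivAt_const (1 : C(X, ℝ)) A).congr_of_eventuallyEq (hsol.mono fun A' h => h.left)
    exact DFunLike.congr_fun (h1.unique h2) C
  · rw [e, map_neg, neg_eq_zero]
    have h1 := (pintR μ).hasFDerivAt.comp A hG
    have h2 : HasFDerivAt (fun A' => pintR μ (paramDensity k κ (A', Ψ A')))
        (0 : P →L[ℝ] C(Y, ℝ)) A :=
      (hasFDerivAt_const (1 : C(Y, ℝ)) A).congr_of_eventuallyEq (hsol.mono fun A' h => h.right)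
    exact DFunLike.congr_fun (h1.unique h2) C

variable [SecondCountableTopology X] [SecondCountableTopology Y]

lemma IsSol.mean_mul_liftL {w : C(X × Y, ℝ)} {u : C(X, ℝ)} {v : C(Y, ℝ)} (h : IsSol μ ν w u v)
    (a : C(X, ℝ)) : mean (μ.prod ν) (density w u v * liftL a) = mean μ a := by
  rw [← mean_pintL, pintL_mul_liftL, h.left, one_mul]

lemma IsSol.mean_mul_liftR {w : C(X × Y, ℝ)} {u : C(X, ℝ)} {v : C(Y, ℝ)} (h : IsSol μ ν w u v)
    (b : C(Y, ℝ)) : mean (μ.prod ν) (density w u v * liftR b) = mean ν b := by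
  rw [← mean_pintR, pintR_mul_liftR, h.right, one_mul]

/-- The density at a solution is bounded below by some `δ ∈ (0, 1]`. -/
lemma IsSol.exists_lower_bound {w : C(X × Y, ℝ)} {u : C(X, ℝ)} {v : C(Y, ℝ)}
    (h : IsSol μ ν w u v) : ∃ δ : ℝ, 0 < δ ∧ δ ≤ 1 ∧ ∀ z, δ ≤ density w u v z := by
  obtain ⟨x₀⟩ := μ.nonempty_of_neZero
  obtain ⟨y₀⟩ := ν.nonempty_of_neZero
  obtain ⟨z₀, -, hz⟩ := isCompact_univ.exists_isMinOn (s := (Set.univ : Set (X × Y)))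
    ⟨(x₀, y₀), trivial⟩ (density w u v).continuous.continuousOn
  refine ⟨density w u v z₀, density_pos _ _ _ _, ?_, fun z => hz trivial⟩
  have h1 := mean_nonneg (μ.prod ν) (f := density w u v - density w u v z₀ • 1) fun z => by
    simpa using hz (Set.mem_univ z)
  rw [map_sub, map_smul, mean_one, ← mean_pintL, h.left, mean_one] at h1
  simpa using h1

/-- The two marginals of the density, with a rank-one term that removes the invariance of the
system under `(u, v) ↦ (u + c, v - c)`. Its level set through a solution consists of solutions. -/
def marginalMap (k : C(X × Y, ℝ)) (κ : P →L[ℝ] C(X × Y, ℝ)) (δ : ℝ)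
    (z : P × (C(X, ℝ) × C(Y, ℝ))) : C(X, ℝ) × C(Y, ℝ) :=
  (pintL ν (paramDensity k κ z) - (δ * mean ν z.2.2) • 1, pintR μ (paramDensity k κ z))

/-- This is the implicit function theorem for `marginalMap`. At a solution, its derivative in (u, v)
is (a, b) ↦ (a + Bb, b + Ta), where T and B integrate against g and g - δ. Without δ both norms
could equal 1 and constants (c, -c) would lie in the kernel; subtracting the lower bound δ of g
gives ‖B‖ ≤ 1 - δ. -/
theorem exists_branch [CompleteSpace P] {k : C(X × Y, ℝ)} {κ : P →L[ℝ] C(X × Y, ℝ)} {A : P}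
    {u : C(X, ℝ)} {v : C(Y, ℝ)} (h : IsSol μ ν (k + κ A) u v) :
    ∃ Ψ : P → C(X, ℝ) × C(Y, ℝ), ContDiffAt ℝ 2 Ψ A ∧ Ψ A = (u, v) ∧
      ∀ᶠ A' in 𝓝 A, IsSol μ ν (k + κ A') (Ψ A').1 (Ψ A').2 := by
  obtain ⟨δ, hδ0, hδ1, hδ⟩ := h.exists_lower_bound
  set g := density (k + κ A) u v with hg
  set z₀ : P × (C(X, ℝ) × C(Y, ℝ)) := (A, (u, v)) with hz₀
  have hgz : paramDensity k κ z₀ = g := rfl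
  let mR : P × (C(X, ℝ) × C(Y, ℝ)) →L[ℝ] C(X, ℝ) :=
    (((δ • mean ν).comp (ContinuousLinearMap.snd ℝ _ _)).comp
      (ContinuousLinearMap.snd ℝ _ _)).smulRight 1
  have hf : ContDiff ℝ 2 (marginalMap μ ν k κ δ) := by
    refine ContDiff.prodMk (ContDiff.sub ?_ mR.contDiff) ?_
    · exact (pintL ν).contDiff.comp (contDiff_paramDensity k κ)
    · exact (pintR μ).contDiff.comp (contDiff_paramDensity k κ)
  have hf' : HasFDerivAt (marginalMap μ ν k κ δ)
      ((((pintL ν).comp ((ContinuousLinearMap.mul ℝ _ g).comp (logLin κ))) - mR).prod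
        ((pintR μ).comp ((ContinuousLinearMap.mul ℝ _ g).comp (logLin κ)))) z₀ := by
    refine HasFDerivAt.prodMk (HasFDerivAt.sub ?_ mR.hasFDerivAt) ?_
    · exact (pintL ν).hasFDerivAt.comp z₀ (hasFDerivAt_paramDensity k κ z₀)
    · exact (pintR μ).hasFDerivAt.comp z₀ (hasFDerivAt_paramDensity k κ z₀)
  let T : C(X, ℝ) →L[ℝ] C(Y, ℝ) := (pintR μ).comp ((ContinuousLinearMap.mul ℝ _ g).comp liftL)
  let B : C(Y, ℝ) →L[ℝ] C(X, ℝ) :=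
    (pintL ν).comp ((ContinuousLinearMap.mul ℝ _ g).comp liftR) - (δ • mean ν).smulRight 1
  -- T averages against the probability density g(·, y).
  have hT : ‖T‖ ≤ 1 := by
    refine T.opNorm_le_bound zero_le_one fun a => ?_
    rw [ContinuousMap.norm_le _ (by positivity)]
    intro y
    have e1 : T a y = ∫ x, g (x, y) * a x ∂μ := rfl
    have e2 : ∫ x, g (x, y) * ‖a‖ ∂μ = ‖a‖ := by
      have := DFunLike.congr_fun h.right y
      rw [pintR_apply, ← hg] at this
      rw [integral_mul_const, this]
      simp
    rw [e1, one_mul]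
    conv_rhs => rw [← e2]
    refine norm_integral_le_of_norm_le ?_ (Eventually.of_forall fun x => ?_)
    · exact (integrable_continuousMap μ
        (g.comp ((ContinuousMap.id X).prodMk (ContinuousMap.const X y)))).mul_const _
    · rw [norm_mul, Real.norm_of_nonneg (hδ0.le.trans (hδ _))]
      exact mul_le_mul_of_nonneg_left (a.norm_coe_le_norm x) (hδ0.le.trans (hδ _))
  -- The kernel g - δ is still nonnegative, and its total mass in y is 1 - δ.
  have hB : ‖B‖ ≤ 1 - δ := by
    refine B.opNorm_le_bound (sub_nonneg.2 hδ1) fun b => ?_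
    rw [ContinuousMap.norm_le _ (mul_nonneg (sub_nonneg.2 hδ1) (norm_nonneg _))]
    intro x
    have ig : Integrable (fun y => g (x, y)) ν := integrable_continuousMap ν
        (g.comp ((ContinuousMap.const Y x).prodMk (ContinuousMap.id Y)))
    have igb : Integrable (fun y => g (x, y) * b y) ν := integrable_continuousMap ν
        (g.comp ((ContinuousMap.const Y x).prodMk (ContinuousMap.id Y)) * b)
    have e1 : B b x = ∫ y, (g (x, y) - δ) * b y ∂ν := by
      simp only [sub_mul]
      rw [integral_sub igb ((integrable_continuousMap ν b).const_mul δ), integral_const_mul]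
      simp [B, pintL_apply, mean_apply]
    have e2 : ∫ y, (g (x, y) - δ) * ‖b‖ ∂ν = (1 - δ) * ‖b‖ := by
      have := DFunLike.congr_fun h.left x
      rw [pintL_apply, ← hg] at this
      rw [integral_mul_const, integral_sub ig (integrable_const _), this]
      simp
    rw [e1, ← e2]
    refine norm_integral_le_of_norm_le ((ig.sub (integrable_const _)).mul_const _)
      (Eventually.of_forall fun y => ?_)
    rw [norm_mul, Real.norm_of_nonneg (sub_nonneg.2 (hδ _))]
    exact mul_le_mul_of_nonneg_left (b.norm_coe_le_norm y) (sub_nonneg.2 (hδ _))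
  have hinv : (fderiv ℝ (marginalMap μ ν k κ δ) z₀ ∘L
      ContinuousLinearMap.inr ℝ P (C(X, ℝ) × C(Y, ℝ))).IsInvertible := by
    refine isInvertible_block (B := B) (T := T) ?_ fun z => ?_
    · calc ‖T‖ * ‖B‖ ≤ 1 * (1 - δ) := by gcongr
        _ < 1 := by linarith
    · rw [hf'.fderiv]
      have e1 : logLin κ (0, z) = liftL z.1 + liftR z.2 := by
        rw [show logLin κ (0, z) = κ 0 + (liftL z.1 + liftR z.2) from rfl, map_zero, zero_add]
      refine Prod.ext ?_ ?_
      · change pintL ν (g * logLin κ (0, z)) - (δ * mean ν z.2) • 1 =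
          z.1 + (pintL ν (g * liftR z.2) - (δ * mean ν z.2) • 1)
        rw [e1, mul_add, map_add, pintL_mul_liftL, h.left, one_mul, add_sub_assoc]
      · change pintR μ (g * logLin κ (0, z)) = z.2 + pintR μ (g * liftL z.1)
        rw [e1, mul_add, map_add, pintR_mul_liftR, h.right, one_mul, add_comm]
  have hfa : ContDiffAt ℝ 2 (marginalMap μ ν k κ δ) z₀ := hf.contDiffAt
  refine ⟨hfa.implicitFunction two_ne_zero hinv, hfa.contDiffAt_implicitFunction two_ne_zero hinv,
    hfa.implicitFunction_apply_self two_ne_zero hinv, ?_⟩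
  filter_upwards [hfa.eventually_apply_implicitFunction two_ne_zero hinv] with A' hA'
  set ψ := hfa.implicitFunction two_ne_zero hinv A'
  have e1 : pintL ν (density (k + κ A') ψ.1 ψ.2) - (δ * mean ν ψ.2) • 1 =
      1 - (δ * mean ν v) • 1 := by
    have e : _ = pintL ν (density (k + κ A) u v) - (δ * mean ν v) • 1 := congrArg Prod.fst hA'
    rwa [h.left] at e
  have e2 : pintR μ (density (k + κ A') ψ.1 ψ.2) = 1 := by
    rw [← h.right]; exact congrArg Prod.snd hA'
  -- Both marginals have the same total mass, so integrating the first equation forces the rank-one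
  -- terms to agree, and they cancel.
  have e3 := congrArg (mean μ) e1
  rw [map_sub, map_sub, mean_pintL, ← mean_pintR, e2, mean_one, mean_one, map_smul, map_smul,
    mean_one] at e3
  have e4 : δ * mean ν ψ.2 = δ * mean ν v := by simpa using e3
  rw [e4] at e1
  exact ⟨sub_left_injective e1, e2⟩

/-! ### Quadratic identities for the linearized system. -/

section LinSol

variable {μ ν}

/-- By Fubini, the two equations make the residual orthogonal, with weight g, to every function of
one variable. -/
lemma IsLinSol.orthogonal {g k : C(X × Y, ℝ)} {a : C(X, ℝ)} {b : C(Y, ℝ)}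
    (h : IsLinSol μ ν g k a b) (a' : C(X, ℝ)) (b' : C(Y, ℝ)) :
    mean (μ.prod ν) (g * ((liftL a + liftR b - k) * (liftL a' + liftR b'))) = 0 := by
  rw [← mul_assoc, mul_add, map_add, ← mean_pintL, ← mean_pintR, pintL_mul_liftL,
    pintR_mul_liftR, h.left, h.right, zero_mul, zero_mul, map_zero, map_zero, add_zero]

/-- This expresses a quantity built from one solution through any other one. It lets the derivative
of the branch be replaced by an arbitrary solution, with no uniqueness result for the linearized
system. -/
lemma IsLinSol.mean_mul_eq {g k : C(X × Y, ℝ)} {a a' : C(X, ℝ)} {b b' : C(Y, ℝ)}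
    (h : IsLinSol μ ν g k a b) (h' : IsLinSol μ ν g k a' b') :
    mean (μ.prod ν) (g * (k * (k - (liftL a' + liftR b')))) =
      - mean (μ.prod ν) (g * ((liftL a + liftR b) ^ 2 - k ^ 2)) := by
  have e1 := h.orthogonal a b
  have e2 := h.orthogonal a' b'
  have e3 := h'.orthogonal a b
  have e4 : g * (k * (k - (liftL a' + liftR b'))) =
      -(g * ((liftL a + liftR b) ^ 2 - k ^ 2)) +
        g * ((liftL a + liftR b - k) * (liftL a' + liftR b')) -
        g * ((liftL a' + liftR b' - k) * (liftL a + liftR b)) +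
        g * ((liftL a + liftR b - k) * (liftL a + liftR b)) := by ring
  rw [e4, map_add, map_sub, map_add, e1, e2, e3, map_neg]
  ring

/-- Pythagoras: a projection does not increase the weighted L² norm. -/
lemma IsLinSol.mean_sq_sub_nonpos {g k : C(X × Y, ℝ)} {a : C(X, ℝ)} {b : C(Y, ℝ)}
    (h : IsLinSol μ ν g k a b) (hg : ∀ z, 0 ≤ g z) :
    mean (μ.prod ν) (g * ((liftL a + liftR b) ^ 2 - k ^ 2)) ≤ 0 := by
  have e1 := h.orthogonal a b
  have e2 := mean_nonneg (μ.prod ν) (f := g * (liftL a + liftR b - k) ^ 2) fun z =>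
    mul_nonneg (hg z) (sq_nonneg _)
  have e3 : g * ((liftL a + liftR b) ^ 2 - k ^ 2) = -(g * (liftL a + liftR b - k) ^ 2) +
      (2 : ℝ) • (g * ((liftL a + liftR b - k) * (liftL a + liftR b))) := by
    ext z
    simp
    ring
  rw [e3, map_add, map_smul, e1, map_neg]
  simpa using e2

/-- Testing orthogonality against the constant 1 shows that the projection has the same mean c as k;
its second moment is then at least c². -/
lemma IsLinSol.le_mean_sq_sub {g k : C(X × Y, ℝ)} {a : C(X, ℝ)} {b : C(Y, ℝ)}
    (h : IsLinSol μ ν g k a b) (hg : ∀ z, 0 ≤ g z) (hg1 : mean (μ.prod ν) g = 1) :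
    mean (μ.prod ν) (g * k) ^ 2 - mean (μ.prod ν) (g * k ^ 2) ≤
      mean (μ.prod ν) (g * ((liftL a + liftR b) ^ 2 - k ^ 2)) := by
  set c := mean (μ.prod ν) (g * k) with hc
  have e1 : mean (μ.prod ν) (g * (liftL a + liftR b)) = c := by
    have := h.orthogonal 1 0
    rw [map_zero, add_zero, show (liftL (1 : C(X, ℝ)) : C(X × Y, ℝ)) = 1 from rfl, mul_one,
      mul_sub, map_sub, sub_eq_zero] at this
    exact this
  have e2 := mean_nonneg (μ.prod ν) (f := g * (liftL a + liftR b - c • 1) ^ 2) fun z =>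
    mul_nonneg (hg z) (sq_nonneg _)
  have e3 : g * (liftL a + liftR b - c • 1) ^ 2 = g * ((liftL a + liftR b) ^ 2 - k ^ 2) +
      g * k ^ 2 - (2 * c) • (g * (liftL a + liftR b)) + c ^ 2 • g := by
    ext z
    simp
    ring
  rw [e3, map_add, map_sub, map_add, map_smul, map_smul, e1, hg1] at e2
  simp only [smul_eq_mul] at e2
  linarith

end LinSol

lemma IsSol.mean_density {w : C(X × Y, ℝ)} {u : C(X, ℝ)} {v : C(Y, ℝ)} (h : IsSol μ ν w u v) :
    mean (μ.prod ν) (density w u v) = 1 := by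
  rw [← mean_pintL, h.left, mean_one]

/-- The functional `C ↦ -∫ κ(C) g`, linear in `g`. -/
def negPairing (κ : P →L[ℝ] C(X × Y, ℝ)) : C(X × Y, ℝ) →L[ℝ] (P →L[ℝ] ℝ) :=
  let M : C(X × Y, ℝ) →L[ℝ] C(X × Y, ℝ) →L[ℝ] C(X × Y, ℝ) := ContinuousLinearMap.mul ℝ _
  let K : (C(X × Y, ℝ) →L[ℝ] C(X × Y, ℝ)) →L[ℝ] (P →L[ℝ] C(X × Y, ℝ)) :=
    (ContinuousLinearMap.compL ℝ P C(X × Y, ℝ) C(X × Y, ℝ)).flip κ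
  (ContinuousLinearMap.compL ℝ P C(X × Y, ℝ) ℝ (-mean (μ.prod ν))).comp (K.comp M)

/-- Envelope formula: since both marginals of the density are 1, integrating the linearized equation
reduces its potential terms to their means. The derivative thus depends on the density alone, not on
the derivative of `Ψ`. -/
lemma hasFDerivAt_meanAdd_branch {k : C(X × Y, ℝ)} {κ : P →L[ℝ] C(X × Y, ℝ)} {A : P}
    {Ψ : P → C(X, ℝ) × C(Y, ℝ)} (hd : DifferentiableAt ℝ Ψ A)
    (hsol : ∀ᶠ A' in 𝓝 A, IsSol μ ν (k + κ A') (Ψ A').1 (Ψ A').2) :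
    HasFDerivAt (fun A' => meanAdd μ ν (Ψ A'))
      (negPairing μ ν κ (paramDensity k κ (A, Ψ A))) A := by
  have h := (meanAdd μ ν).hasFDerivAt.comp A hd.hasFDerivAt
  refine h.congr_fderiv (ContinuousLinearMap.ext fun C => ?_)
  have hs := hsol.self_of_nhds
  have hl := (isLinSol_of_branch μ ν hd hsol C).left
  apply_fun mean μ at hl
  rw [mean_pintL, mul_sub, mul_add, map_sub, map_add, map_zero, hs.mean_mul_liftL,
    hs.mean_mul_liftR, map_neg, map_neg] at hl
  change mean μ (fderiv ℝ Ψ A C).1 + mean ν (fderiv ℝ Ψ A C).2 =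
    -mean (μ.prod ν) (density (k + κ A) (Ψ A).1 (Ψ A).2 * κ C)
  linarith

theorem fderiv_fderiv_meanAdd_branch {k : C(X × Y, ℝ)} {κ : P →L[ℝ] C(X × Y, ℝ)} {A : P}
    {Ψ : P → C(X, ℝ) × C(Y, ℝ)} (hΨ : ContDiffAt ℝ 2 Ψ A)
    (hsol : ∀ᶠ A' in 𝓝 A, IsSol μ ν (k + κ A') (Ψ A').1 (Ψ A').2) {C : P}
    {a : C(X, ℝ)} {b : C(Y, ℝ)}
    (hab : IsLinSol μ ν (density (k + κ A) (Ψ A).1 (Ψ A).2) (κ C) a b) :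
    fderiv ℝ (fderiv ℝ fun A' => meanAdd μ ν (Ψ A')) A C C =
      mean (μ.prod ν) (density (k + κ A) (Ψ A).1 (Ψ A).2 *
        ((liftL a + liftR b) ^ 2 - κ C ^ 2)) := by
  have h1 : fderiv ℝ (fun A' => meanAdd μ ν (Ψ A')) =ᶠ[𝓝 A]
      fun A' => negPairing μ ν κ (paramDensity k κ (A', Ψ A')) := by
    filter_upwards [hΨ.eventually (by simp), hsol.eventually_nhds] with A' hd hs
    exact (hasFDerivAt_meanAdd_branch μ ν (hd.differentiableAt two_ne_zero) hs).fderiv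
  have hd := hΨ.differentiableAt two_ne_zero
  have hG := HasFDerivAt.comp (f := fun A' => (A', Ψ A')) A (hasFDerivAt_paramDensity k κ (A, Ψ A))
      ((hasFDerivAt_id A).prodMk hd.hasFDerivAt)
  have h2 := (negPairing μ ν κ).hasFDerivAt.comp A hG
  have h3 := h1.fderiv_eq.trans h2.fderiv
  rw [h3]
  -- The chain rule produces the solution -DΨ(C) of the linearized system; it is exchanged here for
  -- (a, b).
  have h4 := hab.mean_mul_eq (isLinSol_of_branch μ ν hd hsol C)
  rw [← neg_eq_iff_eq_neg] at h4
  rw [← h4]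
  change -mean (μ.prod ν) (density (k + κ A) (Ψ A).1 (Ψ A).2 * logLin κ (C, fderiv ℝ Ψ A C) *
    κ C) = _
  congr 2
  rw [show logLin κ (C, fderiv ℝ Ψ A C) = κ C + (liftL (fderiv ℝ Ψ A C).1 +
    liftR (fderiv ℝ Ψ A C).2) from rfl, map_neg, map_neg]
  ring

end EGW
end Branch

/-! ### The Gibbs measure as the unique optimal coupling. -/

noncomputable section Gibbs

namespace EGW

open InformationTheory

lemma integrable_of_continuous_of_ae_mem {α : Type*} [TopologicalSpace α] [T2Space α]
    [MeasurableSpace α] [BorelSpace α] [SecondCountableTopology α] {μ : Measure α}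
    [IsFiniteMeasure μ] {K : Set α} (hK : IsCompact K) (h : ∀ᵐ x ∂μ, x ∈ K) {f : α → ℝ}
    (hf : Continuous f) : Integrable f μ := by
  rw [← Measure.restrict_eq_self_of_ae_mem h]
  exact hf.continuousOn.integrableOn_compact hK

lemma integrable_of_isCompact_support {d : ℕ} {μ : Measure (E d)} [IsFiniteMeasure μ]
    (hμ : IsCompact μ.support) {f : E d → ℝ} (hf : Continuous f) : Integrable f μ :=
  integrable_of_continuous_of_ae_mem hμ Measure.support_mem_ae hf

variable {d₀ d₁ : ℕ}

lemma continuous_bil (C : Mat d₀ d₁) : Continuous fun z : E d₀ × E d₁ => bil C z.1 z.2 := by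
  unfold bil; fun_prop

lemma continuous_cost (A : Mat d₀ d₁) : Continuous fun z : E d₀ × E d₁ => cost A z.1 z.2 := by
  unfold cost bil; fun_prop

variable {μ₀ : Measure (E d₀)} {μ₁ : Measure (E d₁)} {π : Measure (E d₀ × E d₁)}
  {ε : ℝ} {A : Mat d₀ d₁} {φ₀ : E d₀ → ℝ} {φ₁ : E d₁ → ℝ}

/-- The logarithm of the Gibbs density, as a function of a pair. -/
def logGibbs (ε : ℝ) (A : Mat d₀ d₁) (φ₀ : E d₀ → ℝ) (φ₁ : E d₁ → ℝ) (z : E d₀ × E d₁) : ℝ :=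
  (φ₀ z.1 + φ₁ z.2 - cost A z.1 z.2) / ε

/-- The measure with the Gibbs density with respect to the product measure. -/
def gibbsMeasure (μ₀ : Measure (E d₀)) (μ₁ : Measure (E d₁)) (ε : ℝ) (A : Mat d₀ d₁)
    (φ₀ : E d₀ → ℝ) (φ₁ : E d₁ → ℝ) : Measure (E d₀ × E d₁) :=
  (μ₀.prod μ₁).tilted (logGibbs ε A φ₀ φ₁)

lemma IsEOTPotentials.continuous_logGibbs (h : IsEOTPotentials μ₀ μ₁ ε A φ₀ φ₁) :
    Continuous (logGibbs ε A φ₀ φ₁) :=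
  (((h.continuous_left.comp continuous_fst).add (h.continuous_right.comp continuous_snd)).sub
    (continuous_cost A)).div_const ε

lemma IsCoupling.ae_mem_support (h : IsCoupling μ₀ μ₁ π) :
    ∀ᵐ z ∂π, z ∈ μ₀.support ×ˢ μ₁.support := by
  have h0 : ∀ᵐ x ∂π.map Prod.fst, x ∈ μ₀.support := by rw [h.1]; exact Measure.support_mem_ae
  have h1 : ∀ᵐ y ∂π.map Prod.snd, y ∈ μ₁.support := by rw [h.2]; exact Measure.support_mem_ae
  filter_upwards [ae_of_ae_map measurable_fst.aemeasurable h0,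
    ae_of_ae_map measurable_snd.aemeasurable h1] with z hz0 hz1
  exact ⟨hz0, hz1⟩

variable [IsProbabilityMeasure μ₀]

lemma IsCoupling.isProbabilityMeasure (h : IsCoupling μ₀ μ₁ π) : IsProbabilityMeasure π := by
  constructor
  rw [← Set.preimage_univ (f := Prod.fst), ← Measure.map_apply measurable_fst MeasurableSet.univ,
    h.1, measure_univ]

lemma IsCoupling.integrable (h : IsCoupling μ₀ μ₁ π) (hμ₀ : IsCompact μ₀.support)
    (hμ₁ : IsCompact μ₁.support) {f : E d₀ × E d₁ → ℝ} (hf : Continuous f) : Integrable f π :=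
  have := h.isProbabilityMeasure
  integrable_of_continuous_of_ae_mem (hμ₀.prod hμ₁) h.ae_mem_support hf

lemma isCoupling_prod [IsProbabilityMeasure μ₁] : IsCoupling μ₀ μ₁ (μ₀.prod μ₁) := by
  constructor <;> simp

variable [IsProbabilityMeasure μ₁]

lemma IsEOTPotentials.integral_exp_logGibbs (h : IsEOTPotentials μ₀ μ₁ ε A φ₀ φ₁)
    (hμ₀ : IsCompact μ₀.support) (hμ₁ : IsCompact μ₁.support) :
    ∫ z, Real.exp (logGibbs ε A φ₀ φ₁ z) ∂μ₀.prod μ₁ = 1 := by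
  rw [integral_prod _ (isCoupling_prod.integrable hμ₀ hμ₁ h.continuous_logGibbs.rexp)]
  have : ∀ x, ∫ y, Real.exp (logGibbs ε A φ₀ φ₁ (x, y)) ∂μ₁ = 1 := h.integral_left
  simp [this]

lemma IsEOTPotentials.gibbsMeasure_apply (h : IsEOTPotentials μ₀ μ₁ ε A φ₀ φ₁)
    (hμ₀ : IsCompact μ₀.support) (hμ₁ : IsCompact μ₁.support) {s : Set (E d₀ × E d₁)}
    (hs : MeasurableSet s) : gibbsMeasure μ₀ μ₁ ε A φ₀ φ₁ s =
      ∫⁻ z in s, ENNReal.ofReal (gibbs ε A φ₀ φ₁ z.1 z.2) ∂μ₀.prod μ₁ := by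
  rw [gibbsMeasure, tilted_apply' _ _ hs, h.integral_exp_logGibbs hμ₀ hμ₁]
  simp only [div_one]
  rfl

lemma IsEOTPotentials.isCoupling_gibbsMeasure (h : IsEOTPotentials μ₀ μ₁ ε A φ₀ φ₁)
    (hμ₀ : IsCompact μ₀.support) (hμ₁ : IsCompact μ₁.support) :
    IsCoupling μ₀ μ₁ (gibbsMeasure μ₀ μ₁ ε A φ₀ φ₁) := by
  have hc : Continuous fun z : E d₀ × E d₁ => gibbs ε A φ₀ φ₁ z.1 z.2 :=
    h.continuous_logGibbs.rexp
  have hm : Measurable fun z : E d₀ × E d₁ => ENNReal.ofReal (gibbs ε A φ₀ φ₁ z.1 z.2) :=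
    hc.measurable.ennreal_ofReal
  constructor
  · ext s hs
    rw [Measure.map_apply measurable_fst hs, h.gibbsMeasure_apply hμ₀ hμ₁ (measurable_fst hs),
      ← Set.prod_univ, ← Measure.prod_restrict, lintegral_prod _ hm.aemeasurable,
      Measure.restrict_univ]
    have : ∀ x, ∫⁻ y, ENNReal.ofReal (gibbs ε A φ₀ φ₁ x y) ∂μ₁ = 1 := fun x => by
      rw [← ofReal_integral_eq_lintegral_ofReal, h.integral_left, ENNReal.ofReal_one]
      · exact integrable_of_isCompact_support hμ₁ (hc.comp (Continuous.prodMk_right x))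
      · exact Filter.Eventually.of_forall fun y => (Real.exp_pos _).le
    simp [this]
  · ext s hs
    rw [Measure.map_apply measurable_snd hs, h.gibbsMeasure_apply hμ₀ hμ₁ (measurable_snd hs),
      ← Set.univ_prod, ← Measure.prod_restrict, lintegral_prod_symm _ hm.aemeasurable,
      Measure.restrict_univ]
    have : ∀ y, ∫⁻ x, ENNReal.ofReal (gibbs ε A φ₀ φ₁ x y) ∂μ₀ = 1 := fun y => by
      rw [← ofReal_integral_eq_lintegral_ofReal, h.integral_right, ENNReal.ofReal_one]
      · exact integrable_of_isCompact_support hμ₀ (hc.comp (Continuous.prodMk_left y))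
      · exact Filter.Eventually.of_forall fun x => (Real.exp_pos _).le
    simp [this]

lemma coe_ofReal_mul_ennreal {ε : ℝ} (hε : 0 ≤ ε) {x : ENNReal} (hx : x ≠ ⊤) :
    ((ENNReal.ofReal ε * x : ENNReal) : EReal) = ((ε * x.toReal : ℝ) : EReal) := by
  rw [← ENNReal.ofReal_toReal hx, ← ENNReal.ofReal_mul hε, EReal.coe_ennreal_ofReal,
    ENNReal.toReal_ofReal ENNReal.toReal_nonneg, max_eq_left (by positivity)]

/-- On couplings, the objective is a relative entropy with respect to the Gibbs measure, up to a
constant. -/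
lemma IsEOTPotentials.eotObjective_eq (h : IsEOTPotentials μ₀ μ₁ ε A φ₀ φ₁) (hε : 0 < ε)
    (hμ₀ : IsCompact μ₀.support) (hμ₁ : IsCompact μ₁.support) (hπ : IsCoupling μ₀ μ₁ π) :
    eotObjective μ₀ μ₁ ε A π = ((∫ x, φ₀ x ∂μ₀ + ∫ y, φ₁ y ∂μ₁ : ℝ) : EReal) +
      ((ENNReal.ofReal ε * klDiv π (gibbsMeasure μ₀ μ₁ ε A φ₀ φ₁) : ENNReal) : EReal) := by
  have hπp := hπ.isProbabilityMeasure
  have hγ := (h.isCoupling_gibbsMeasure hμ₀ hμ₁).isProbabilityMeasure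
  have hexp : Integrable (fun z => Real.exp (logGibbs ε A φ₀ φ₁ z)) (μ₀.prod μ₁) :=
    isCoupling_prod.integrable hμ₀ hμ₁ h.continuous_logGibbs.rexp
  have hint : Integrable (logGibbs ε A φ₀ φ₁) π := hπ.integrable hμ₀ hμ₁ h.continuous_logGibbs
  have hone := h.integral_exp_logGibbs hμ₀ hμ₁
  rw [eotObjective]
  -- The log-density `logGibbs` is integrable against every coupling, so the entropies relative to
  -- the product and to the Gibbs measure are finite together. If they are infinite, both sides are
  -- ⊤.
  by_cases hk : π ≪ μ₀.prod μ₁ ∧ Integrable (llr π (μ₀.prod μ₁)) π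
  · obtain ⟨hac, hllr⟩ := hk
    have hac' : π ≪ gibbsMeasure μ₀ μ₁ ε A φ₀ φ₁ :=
      hac.trans (absolutelyContinuous_tilted hexp)
    have hllr' : Integrable (llr π (gibbsMeasure μ₀ μ₁ ε A φ₀ φ₁)) π :=
      integrable_llr_tilted_right hac hint hllr hexp
    rw [coe_ofReal_mul_ennreal hε.le (klDiv_ne_top hac hllr),
      coe_ofReal_mul_ennreal hε.le (klDiv_ne_top hac' hllr'), ← EReal.coe_add, ← EReal.coe_add,
      toReal_klDiv_of_measure_eq hac (by simp), toReal_klDiv_of_measure_eq hac' (by simp),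
      gibbsMeasure, integral_llr_tilted_right hac hint hexp hllr, hone, Real.log_one]
    congr 1
    have e0 : ∫ z, φ₀ z.1 ∂π = ∫ x, φ₀ x ∂μ₀ := by
      rw [← hπ.1, integral_map measurable_fst.aemeasurable]
      exact h.continuous_left.aestronglyMeasurable
    have e1 : ∫ z, φ₁ z.2 ∂π = ∫ y, φ₁ y ∂μ₁ := by
      rw [← hπ.2, integral_map measurable_snd.aemeasurable]
      exact h.continuous_right.aestronglyMeasurable
    have i0 : Integrable (fun z : E d₀ × E d₁ => φ₀ z.1) π :=
      hπ.integrable hμ₀ hμ₁ (h.continuous_left.comp continuous_fst)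
    have i1 : Integrable (fun z : E d₀ × E d₁ => φ₁ z.2) π :=
      hπ.integrable hμ₀ hμ₁ (h.continuous_right.comp continuous_snd)
    have e2 : ∫ z, logGibbs ε A φ₀ φ₁ z ∂π =
        (∫ x, φ₀ x ∂μ₀ + ∫ y, φ₁ y ∂μ₁ - ∫ z, cost A z.1 z.2 ∂π) / ε := by
      simp only [logGibbs]
      have e3 := integral_sub (i0.add i1) (hπ.integrable hμ₀ hμ₁ (continuous_cost A))
      simp only [Pi.add_apply] at e3
      rw [integral_div, e3, integral_add i0 i1, e0, e1]
    rw [e2]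
    field_simp
    ring
  · have hk' : ¬(π ≪ gibbsMeasure μ₀ μ₁ ε A φ₀ φ₁ ∧
        Integrable (llr π (gibbsMeasure μ₀ μ₁ ε A φ₀ φ₁)) π) := by
      rintro ⟨hac', hllr'⟩
      have hac : π ≪ μ₀.prod μ₁ := hac'.trans (tilted_absolutelyContinuous _ _)
      refine hk ⟨hac, ?_⟩
      refine (hllr'.add hint).congr ?_
      filter_upwards [llr_tilted_right hac hexp] with z hz
      rw [gibbsMeasure, Pi.add_apply, hz, hone, Real.log_one]
      ring
    have ht : ENNReal.ofReal ε * ⊤ = ⊤ := ENNReal.mul_top (by simpa using hε)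
    rw [← klDiv_ne_top_iff, not_not] at hk hk'
    rw [hk, hk', ht, EReal.coe_ennreal_top, EReal.coe_add_top, EReal.coe_add_top]

lemma IsEOTPotentials.eotObjective_gibbsMeasure (h : IsEOTPotentials μ₀ μ₁ ε A φ₀ φ₁)
    (hε : 0 < ε) (hμ₀ : IsCompact μ₀.support) (hμ₁ : IsCompact μ₁.support) :
    eotObjective μ₀ μ₁ ε A (gibbsMeasure μ₀ μ₁ ε A φ₀ φ₁) =
      ((∫ x, φ₀ x ∂μ₀ + ∫ y, φ₁ y ∂μ₁ : ℝ) : EReal) := by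
  have hγ := h.isCoupling_gibbsMeasure hμ₀ hμ₁
  have := hγ.isProbabilityMeasure
  rw [h.eotObjective_eq hε hμ₀ hμ₁ hγ, klDiv_self]
  simp

lemma IsEOTPotentials.eotObjective_ge (h : IsEOTPotentials μ₀ μ₁ ε A φ₀ φ₁)
    (hε : 0 < ε) (hμ₀ : IsCompact μ₀.support) (hμ₁ : IsCompact μ₁.support)
    (hπ : IsCoupling μ₀ μ₁ π) :
    ((∫ x, φ₀ x ∂μ₀ + ∫ y, φ₁ y ∂μ₁ : ℝ) : EReal) ≤ eotObjective μ₀ μ₁ ε A π := by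
  rw [h.eotObjective_eq hε hμ₀ hμ₁ hπ]
  exact le_add_of_nonneg_right (EReal.coe_ennreal_nonneg _)

theorem IsEOTPotentials.isEOTCoupling_gibbsMeasure (h : IsEOTPotentials μ₀ μ₁ ε A φ₀ φ₁)
    (hε : 0 < ε) (hμ₀ : IsCompact μ₀.support) (hμ₁ : IsCompact μ₁.support) :
    IsEOTCoupling μ₀ μ₁ ε A (gibbsMeasure μ₀ μ₁ ε A φ₀ φ₁) := by
  refine ⟨h.isCoupling_gibbsMeasure hμ₀ hμ₁, fun π' hπ' => ?_⟩
  rw [h.eotObjective_gibbsMeasure hε hμ₀ hμ₁]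
  exact h.eotObjective_ge hε hμ₀ hμ₁ hπ'

theorem IsEOTPotentials.eq_gibbsMeasure (h : IsEOTPotentials μ₀ μ₁ ε A φ₀ φ₁) (hε : 0 < ε)
    (hμ₀ : IsCompact μ₀.support) (hμ₁ : IsCompact μ₁.support) (hπ : IsEOTCoupling μ₀ μ₁ ε A π) :
    π = gibbsMeasure μ₀ μ₁ ε A φ₀ φ₁ := by
  have hγ := h.isCoupling_gibbsMeasure hμ₀ hμ₁
  have := hγ.isProbabilityMeasure
  have := hπ.1.isProbabilityMeasure
  have hle := hπ.2 _ hγ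
  rw [h.eotObjective_gibbsMeasure hε hμ₀ hμ₁, h.eotObjective_eq hε hμ₀ hμ₁ hπ.1] at hle
  rw [← klDiv_eq_zero_iff]
  have h0 : ENNReal.ofReal ε * klDiv π (gibbsMeasure μ₀ μ₁ ε A φ₀ φ₁) = 0 := by
    by_contra hne
    have hpos : (0 : EReal) <
        ((ENNReal.ofReal ε * klDiv π (gibbsMeasure μ₀ μ₁ ε A φ₀ φ₁) : ENNReal) : EReal) :=
      EReal.coe_ennreal_pos.2 (pos_iff_ne_zero.2 hne)
    have := EReal.add_lt_add_left_coe hpos (∫ x, φ₀ x ∂μ₀ + ∫ y, φ₁ y ∂μ₁)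
    rw [add_zero] at this
    exact this.not_ge hle
  exact (mul_eq_zero.1 h0).resolve_left (by simpa using hε)

theorem IsEOTPotentials.OT_eq (h : IsEOTPotentials μ₀ μ₁ ε A φ₀ φ₁) (hε : 0 < ε)
    (hμ₀ : IsCompact μ₀.support) (hμ₁ : IsCompact μ₁.support) :
    OT μ₀ μ₁ ε A = ∫ x, φ₀ x ∂μ₀ + ∫ y, φ₁ y ∂μ₁ := by
  have : (⨅ π ∈ {π | IsCoupling μ₀ μ₁ π}, eotObjective μ₀ μ₁ ε A π) =
      ((∫ x, φ₀ x ∂μ₀ + ∫ y, φ₁ y ∂μ₁ : ℝ) : EReal) := by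
    refine le_antisymm ?_ (le_iInf₂ fun π hπ => h.eotObjective_ge hε hμ₀ hμ₁ hπ)
    rw [← h.eotObjective_gibbsMeasure hε hμ₀ hμ₁]
    exact iInf₂_le _ (h.isCoupling_gibbsMeasure hμ₀ hμ₁)
  rw [OT, this, EReal.toReal_coe]

end EGW

end Gibbs

/-! ### Extreme eigenvalues of a symmetric matrix as extrema over the unit sphere. -/

noncomputable section Eigen
namespace EGW

-- The sphere is compact, so the quadratic form attains its minimum, and a minimizer is an
-- eigenvector by the Rayleigh quotient principle.
open Matrix in
lemma exists_hasEigenvalue_of_isMinOn_sphere {ι : Type} [Fintype ι] [DecidableEq ι] [Nonempty ι]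
    {H : Matrix ι ι ℝ} (hH : H.IsSymm) :
    ∃ C : EuclideanSpace ℝ ι, ‖C‖ = 1 ∧
      (∀ D : EuclideanSpace ℝ ι, ‖D‖ = 1 → C.ofLp ⬝ᵥ H *ᵥ C.ofLp ≤ D.ofLp ⬝ᵥ H *ᵥ D.ofLp) ∧
      IsLeast (eigenvalueSet H) (C.ofLp ⬝ᵥ H *ᵥ C.ofLp) := by
  set T : EuclideanSpace ℝ ι →L[ℝ] EuclideanSpace ℝ ι := Matrix.toEuclideanCLM (𝕜 := ℝ) H with hT
  have hTa : ∀ v : EuclideanSpace ℝ ι, (T v).ofLp = H *ᵥ v.ofLp := fun v => rfl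
  have hTs : IsSelfAdjoint T := by
    rw [IsSelfAdjoint, hT, ← map_star]
    exact congrArg _ ((Matrix.conjTranspose_eq_transpose_of_trivial H).trans hH.eq)
  have hQ : ∀ v : EuclideanSpace ℝ ι, T.reApplyInnerSelf v = v.ofLp ⬝ᵥ H *ᵥ v.ofLp := fun v => by
    rw [ContinuousLinearMap.reApplyInnerSelf_apply, ← hTa, EuclideanSpace.inner_eq_star_dotProduct]
    simp
  have hne : (Metric.sphere (0 : EuclideanSpace ℝ ι) 1).Nonempty :=
    NormedSpace.sphere_nonempty.2 zero_le_one
  obtain ⟨C, hC, hmin⟩ := (isCompact_sphere (0 : EuclideanSpace ℝ ι) 1).exists_isMinOn hne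
    T.reApplyInnerSelf_continuous.continuousOn
  have hC1 : ‖C‖ = 1 := by simpa using hC
  have hC0 : C ≠ 0 := by rw [← norm_ne_zero_iff, hC1]; exact one_ne_zero
  have hle : ∀ D : EuclideanSpace ℝ ι, ‖D‖ = 1 →
      C.ofLp ⬝ᵥ H *ᵥ C.ofLp ≤ D.ofLp ⬝ᵥ H *ᵥ D.ofLp := fun D hD => by
    rw [← hQ, ← hQ]; exact hmin (by simpa using hD)
  refine ⟨C, hC1, hle, ?_, ?_⟩
  · have h := hTs.hasEigenvector_of_isLocalExtrOn hC0
      (Or.inl (by rw [hC1]; exact IsMinOn.localize hmin))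
    have hev : T C = (C.ofLp ⬝ᵥ H *ᵥ C.ofLp) • C := by
      have := h.apply_eq_smul
      simpa [ContinuousLinearMap.rayleighQuotient, hC1, hQ] using this
    refine Module.End.hasEigenvalue_of_hasEigenvector (x := C.ofLp) ⟨?_, ?_⟩
    · rw [Module.End.mem_eigenspace_iff, Matrix.toLin'_apply]
      exact congrArg WithLp.ofLp hev
    · simpa using hC0
  · rintro l hl
    obtain ⟨x, hx⟩ := Module.End.HasEigenvalue.exists_hasEigenvector hl
    have hxe : H *ᵥ x = l • x := by simpa using hx.apply_eq_smul
    have hx0 : WithLp.toLp 2 x ≠ 0 := by simpa using hx.2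
    have hn : ‖WithLp.toLp 2 x‖ ≠ 0 := norm_ne_zero_iff.2 hx0
    -- At a normalized eigenvector the quadratic form equals the eigenvalue.
    have h := hle (‖WithLp.toLp 2 x‖⁻¹ • WithLp.toLp 2 x) (by
      rw [norm_smul, norm_inv, norm_norm, inv_mul_cancel₀ hn])
    have hxx : x ⬝ᵥ x = ‖WithLp.toLp 2 x‖ ^ 2 := by
      rw [EuclideanSpace.real_norm_sq_eq]
      simp [dotProduct, pow_two]
    simp only [WithLp.ofLp_smul, Matrix.mulVec_smul, hxe, dotProduct_smul, smul_dotProduct, hxx,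
      smul_eq_mul] at h
    refine h.trans_eq ?_
    field_simp

open Matrix in
lemma exists_hasEigenvalue_of_isMaxOn_sphere {ι : Type} [Fintype ι] [DecidableEq ι] [Nonempty ι]
    {H : Matrix ι ι ℝ} (hH : H.IsSymm) :
    ∃ C : EuclideanSpace ℝ ι, ‖C‖ = 1 ∧
      IsGreatest (eigenvalueSet H) (C.ofLp ⬝ᵥ H *ᵥ C.ofLp) := by
  have hneg : ∀ {l : ℝ} {K : Matrix ι ι ℝ}, l ∈ eigenvalueSet K → -l ∈ eigenvalueSet (-K) := by
    intro l K hl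
    obtain ⟨x, hx⟩ := Module.End.HasEigenvalue.exists_hasEigenvector hl
    refine Module.End.hasEigenvalue_of_hasEigenvector (x := x) ⟨?_, hx.2⟩
    have hxe : K *ᵥ x = l • x := by simpa using hx.apply_eq_smul
    rw [Module.End.mem_eigenspace_iff, Matrix.toLin'_apply, Matrix.neg_mulVec, hxe, neg_smul]
  obtain ⟨C, hC, -, h1, h2⟩ := exists_hasEigenvalue_of_isMinOn_sphere hH.neg
  refine ⟨C, hC, ?_, fun l hl => ?_⟩
  · have := hneg h1
    simpa [Matrix.neg_mulVec] using this
  · have := h2 (hneg hl)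
    simpa [Matrix.neg_mulVec] using this

end EGW
end Eigen

/-! ### Passage between Euclidean space and the compact supports. -/

noncomputable section Transfer

namespace EGW

open Filter Topology

/-- The restriction of a measure to its support, as a measure on the support. -/
def supportMeasure {d : ℕ} (μ : Measure (E d)) : Measure μ.support :=
  μ.comap Subtype.val

lemma measurableEmbedding_support {d : ℕ} (μ : Measure (E d)) :
    MeasurableEmbedding (Subtype.val : μ.support → E d) :=
  MeasurableEmbedding.subtype_coe Measure.isClosed_support.measurableSet

lemma map_supportMeasure {d : ℕ} (μ : Measure (E d)) :
    (supportMeasure μ).map Subtype.val = μ := by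
  have h : ∀ᵐ x ∂μ, x ∈ μ.support := Measure.support_mem_ae
  rw [supportMeasure, map_comap_subtype_coe Measure.isClosed_support.measurableSet,
    Measure.restrict_eq_self_of_ae_mem h]

instance {d : ℕ} (μ : Measure (E d)) [IsProbabilityMeasure μ] :
    IsProbabilityMeasure (supportMeasure μ) := by
  constructor
  rw [← Set.preimage_univ (f := (Subtype.val : μ.support → E d)),
    ← (measurableEmbedding_support μ).map_apply, map_supportMeasure, measure_univ]

lemma integral_supportMeasure {d : ℕ} (μ : Measure (E d)) (f : E d → ℝ) :
    ∫ x, f x ∂supportMeasure μ = ∫ x, f x ∂μ := by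
  conv_rhs => rw [← map_supportMeasure μ, (measurableEmbedding_support μ).integral_map]

variable {d₀ d₁ : ℕ} {μ₀ : Measure (E d₀)} {μ₁ : Measure (E d₁)}
  [CompactSpace μ₀.support] [CompactSpace μ₁.support]

/-- The part `4 ‖x‖² ‖y‖² / ε` of the log-kernel `-c_A(x, y) / ε`. -/
def kernelConst (μ₀ : Measure (E d₀)) (μ₁ : Measure (E d₁)) (ε : ℝ) :
    C(μ₀.support × μ₁.support, ℝ) where
  toFun z := 4 * ‖(z.1 : E d₀)‖ ^ 2 * ‖(z.2 : E d₁)‖ ^ 2 / ε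

lemma bil_add (B C : Mat d₀ d₁) (x : E d₀) (y : E d₁) : bil (B + C) x y = bil B x y + bil C x y := by
  simp only [bil, PiLp.add_apply, ← Finset.sum_add_distrib]
  refine Finset.sum_congr rfl fun i _ => Finset.sum_congr rfl fun j _ => ?_
  ring

lemma bil_smul (c : ℝ) (C : Mat d₀ d₁) (x : E d₀) (y : E d₁) : bil (c • C) x y = c * bil C x y := by
  simp only [bil, PiLp.smul_apply, Finset.mul_sum, smul_eq_mul]
  refine Finset.sum_congr rfl fun i _ => Finset.sum_congr rfl fun j _ => ?_
  ring

/-- The part `32 xᵀ A y / ε` of the log-kernel `-c_A(x, y) / ε`, linear in `A`. -/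
def kernelLin (μ₀ : Measure (E d₀)) (μ₁ : Measure (E d₁)) [CompactSpace μ₀.support]
    [CompactSpace μ₁.support] (ε : ℝ) : Mat d₀ d₁ →L[ℝ] C(μ₀.support × μ₁.support, ℝ) :=
  LinearMap.toContinuousLinearMap
    { toFun := fun A => ⟨fun z => 32 * bil A z.1 z.2 / ε, by unfold bil; fun_prop⟩
      map_add' := fun B C => by
        ext z
        simp only [ContinuousMap.coe_mk, bil_add, ContinuousMap.add_apply]
        ring
      map_smul' := fun c C => by
        ext z
        simp only [ContinuousMap.coe_mk, bil_smul, ContinuousMap.smul_apply, smul_eq_mul,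
          RingHom.id_apply]
        ring }

lemma kernelLin_apply (ε : ℝ) (A : Mat d₀ d₁) (z : μ₀.support × μ₁.support) :
    kernelLin μ₀ μ₁ ε A z = 32 * bil A z.1 z.2 / ε := rfl

/-- The log-kernel `-c_A(x, y) / ε` on the supports. -/
def kernel (μ₀ : Measure (E d₀)) (μ₁ : Measure (E d₁)) [CompactSpace μ₀.support]
    [CompactSpace μ₁.support] (ε : ℝ) (A : Mat d₀ d₁) : C(μ₀.support × μ₁.support, ℝ) :=
  kernelConst μ₀ μ₁ ε + kernelLin μ₀ μ₁ ε A

lemma kernel_apply (ε : ℝ) (A : Mat d₀ d₁) (z : μ₀.support × μ₁.support) :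
    kernel μ₀ μ₁ ε A z = -cost A z.1 z.2 / ε := by
  rw [kernel, ContinuousMap.add_apply, kernelLin_apply, cost]
  simp only [kernelConst, ContinuousMap.coe_mk]
  ring

/-- A function that is continuous on the support, divided by `ε`, as an element of `C(spt μ)`. -/
def restrictDiv {d : ℕ} {μ : Measure (E d)} (ε : ℝ) {f : E d → ℝ} (hf : ContinuousOn f μ.support) :
    C(μ.support, ℝ) where
  toFun x := f x / ε
  continuous_toFun := (continuousOn_iff_continuous_domRestrict.1 hf).div_const ε

lemma restrictDiv_apply {d : ℕ} {μ : Measure (E d)} (ε : ℝ) {f : E d → ℝ}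
    (hf : ContinuousOn f μ.support) (x : μ.support) : restrictDiv ε hf x = f x / ε := rfl

variable {ε : ℝ} {A : Mat d₀ d₁} {φ₀ : E d₀ → ℝ} {φ₁ : E d₁ → ℝ}

lemma density_kernel_apply {u : C(μ₀.support, ℝ)} {v : C(μ₁.support, ℝ)}
    {z : μ₀.support × μ₁.support} (hu : u z.1 = φ₀ z.1 / ε) (hv : v z.2 = φ₁ z.2 / ε) :
    density (kernel μ₀ μ₁ ε A) u v z = gibbs ε A φ₀ φ₁ z.1 z.2 := by
  rw [density_apply, kernel_apply, hu, hv, gibbs]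
  ring_nf

variable [IsProbabilityMeasure μ₀] [IsProbabilityMeasure μ₁]

lemma IsEOTPotentials.isSol (h : IsEOTPotentials μ₀ μ₁ ε A φ₀ φ₁) :
    IsSol (supportMeasure μ₀) (supportMeasure μ₁) (kernel μ₀ μ₁ ε A)
      (restrictDiv ε h.continuous_left.continuousOn)
      (restrictDiv ε h.continuous_right.continuousOn) := by
  constructor
  · ext x
    refine Eq.trans ?_ (h.integral_left x)
    rw [pintL_apply, ← integral_supportMeasure]
    exact integral_congr_ae (Eventually.of_forall fun y => density_kernel_apply rfl rfl)
  · ext y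
    refine Eq.trans ?_ (h.integral_right y)
    rw [pintR_apply, ← integral_supportMeasure]
    exact integral_congr_ae (Eventually.of_forall fun x => density_kernel_apply rfl rfl)

/-- A solution on the supports extends to a pair of EOT potentials. -/
theorem IsSol.exists_isEOTPotentials (hε : 0 < ε) {u : C(μ₀.support, ℝ)} {v : C(μ₁.support, ℝ)}
    (h : IsSol (supportMeasure μ₀) (supportMeasure μ₁) (kernel μ₀ μ₁ ε A) u v) :
    ∃ φ₀ φ₁, IsEOTPotentials μ₀ μ₁ ε A φ₀ φ₁ ∧ (∀ x : μ₀.support, u x = φ₀ x / ε) ∧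
      ∀ y : μ₁.support, v y = φ₁ y / ε := by
  -- On the supports the system reads u = -log Z₀ and v = -log Z₁. The right-hand sides make sense
  -- and are continuous everywhere, so they define the extension; the integrals only see the
  -- supports, so the equations hold at all points.
  set Z₀ : E d₀ → ℝ := fun x =>
    ∫ y : μ₁.support, Real.exp (v y - cost A x y / ε) ∂supportMeasure μ₁ with hZ₀
  set Z₁ : E d₁ → ℝ := fun y =>
    ∫ x : μ₀.support, Real.exp (u x - cost A x y / ε) ∂supportMeasure μ₀ with hZ₁
  have c0 : Continuous fun p : E d₀ × μ₁.support => Real.exp (v p.2 - cost A p.1 p.2 / ε) := by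
    have := (continuous_cost A).comp
      (continuous_fst.prodMk (continuous_subtype_val.comp continuous_snd) :
        Continuous fun p : E d₀ × μ₁.support => (p.1, (p.2 : E d₁)))
    exact ((v.continuous.comp continuous_snd).sub (this.div_const ε)).rexp
  have c1 : Continuous fun p : E d₁ × μ₀.support => Real.exp (u p.2 - cost A p.2 p.1 / ε) := by
    have := (continuous_cost A).comp
      ((continuous_subtype_val.comp continuous_snd).prodMk continuous_fst :
        Continuous fun p : E d₁ × μ₀.support => ((p.2 : E d₀), p.1))
    exact ((u.continuous.comp continuous_snd).sub (this.div_const ε)).rexp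
  have hcZ₀ : Continuous Z₀ := by
    have := continuous_parametric_integral_of_continuous (μ := supportMeasure μ₁)
      (f := fun x (y : μ₁.support) => Real.exp (v y - cost A x y / ε)) c0 isCompact_univ
    simpa only [Measure.restrict_univ] using this
  have hcZ₁ : Continuous Z₁ := by
    have := continuous_parametric_integral_of_continuous (μ := supportMeasure μ₀)
      (f := fun y (x : μ₀.support) => Real.exp (u x - cost A x y / ε)) c1 isCompact_univ
    simpa only [Measure.restrict_univ] using this
  have hpZ₀ : ∀ x, 0 < Z₀ x := fun x =>
    integral_exp_pos (integrable_continuousMap (supportMeasure μ₁)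
      ⟨_, c0.comp (Continuous.prodMk_right x)⟩)
  have hpZ₁ : ∀ y, 0 < Z₁ y := fun y =>
    integral_exp_pos (integrable_continuousMap (supportMeasure μ₀)
      ⟨_, c1.comp (Continuous.prodMk_right y)⟩)
  have hu : ∀ x : μ₀.support, u x = -Real.log (Z₀ x) := fun x => by
    have h1 := DFunLike.congr_fun h.left x
    have h2 : ∀ y, density (kernel μ₀ μ₁ ε A) u v (x, y) =
        Real.exp (u x) * Real.exp (v y - cost A x y / ε) := fun y => by
      rw [density_apply, kernel_apply, ← Real.exp_add]
      ring_nf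
    rw [pintL_apply] at h1
    simp only [h2] at h1
    rw [integral_const_mul, ContinuousMap.one_apply] at h1
    have h3 := congrArg Real.log h1
    rw [Real.log_mul (Real.exp_pos _).ne' (hpZ₀ x).ne', Real.log_exp, Real.log_one] at h3
    exact eq_neg_of_add_eq_zero_left h3
  have hv : ∀ y : μ₁.support, v y = -Real.log (Z₁ y) := fun y => by
    have h1 := DFunLike.congr_fun h.right y
    have h2 : ∀ x, density (kernel μ₀ μ₁ ε A) u v (x, y) =
        Real.exp (v y) * Real.exp (u x - cost A x y / ε) := fun x => by
      rw [density_apply, kernel_apply, ← Real.exp_add]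
      ring_nf
    rw [pintR_apply] at h1
    simp only [h2] at h1
    rw [integral_const_mul, ContinuousMap.one_apply] at h1
    have h3 := congrArg Real.log h1
    rw [Real.log_mul (Real.exp_pos _).ne' (hpZ₁ y).ne', Real.log_exp, Real.log_one] at h3
    exact eq_neg_of_add_eq_zero_left h3
  have e0 : ∀ a : ℝ, ε * a / ε = a := fun a => mul_div_cancel_left₀ a hε.ne'
  refine ⟨fun x => ε * -Real.log (Z₀ x), fun y => ε * -Real.log (Z₁ y), ⟨?_, ?_, ?_, ?_⟩,
    fun x => by rw [hu, e0], fun y => by rw [hv, e0]⟩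
  · exact ((hcZ₀.log fun x => (hpZ₀ x).ne').neg).const_mul ε
  · exact ((hcZ₁.log fun x => (hpZ₁ x).ne').neg).const_mul ε
  · intro x
    rw [← integral_supportMeasure]
    have : ∀ y : μ₁.support, gibbs ε A (fun x => ε * -Real.log (Z₀ x))
        (fun y => ε * -Real.log (Z₁ y)) x y = (Z₀ x)⁻¹ * Real.exp (v y - cost A x y / ε) := by
      intro y
      rw [gibbs, ← hv y, sub_div, add_div, e0, e0, add_sub_assoc, Real.exp_add, Real.exp_neg,
        Real.exp_log (hpZ₀ x)]
    simp only [this]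
    rw [integral_const_mul]
    exact inv_mul_cancel₀ (hpZ₀ x).ne'
  · intro y
    rw [← integral_supportMeasure]
    have : ∀ x : μ₀.support, gibbs ε A (fun x => ε * -Real.log (Z₀ x))
        (fun y => ε * -Real.log (Z₁ y)) x y = (Z₁ y)⁻¹ * Real.exp (u x - cost A x y / ε) := by
      intro x
      rw [gibbs, ← hu x, sub_div, add_div, e0, e0, add_comm (u x), add_sub_assoc, Real.exp_add,
        Real.exp_neg, Real.exp_log (hpZ₁ y)]
    simp only [this]
    rw [integral_const_mul]
    exact inv_mul_cancel₀ (hpZ₁ y).ne'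

theorem exists_isEOTPotentials (μ₀ : Measure (E d₀)) (μ₁ : Measure (E d₁))
    [CompactSpace μ₀.support] [CompactSpace μ₁.support]
    [IsProbabilityMeasure μ₀] [IsProbabilityMeasure μ₁] (hε : 0 < ε) (A : Mat d₀ d₁) :
    ∃ φ₀ φ₁, IsEOTPotentials μ₀ μ₁ ε A φ₀ φ₁ := by
  obtain ⟨u, v, h⟩ := exists_isSol (supportMeasure μ₀) (supportMeasure μ₁) (kernel μ₀ μ₁ ε A)
  obtain ⟨φ₀, φ₁, h, -⟩ := h.exists_isEOTPotentials hε
  exact ⟨φ₀, φ₁, h⟩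

lemma SolvesLinearized.isLinSol (h : IsEOTPotentials μ₀ μ₁ ε A φ₀ φ₁) {C : Mat d₀ d₁}
    {h₀ : E d₀ → ℝ} {h₁ : E d₁ → ℝ} (hC : SolvesLinearized μ₀ μ₁ ε A φ₀ φ₁ C h₀ h₁) :
    IsLinSol (supportMeasure μ₀) (supportMeasure μ₁)
      (density (kernel μ₀ μ₁ ε A) (restrictDiv ε h.continuous_left.continuousOn)
        (restrictDiv ε h.continuous_right.continuousOn)) (kernelLin μ₀ μ₁ ε C)
      (restrictDiv ε hC.continuousOn_left) (restrictDiv ε hC.continuousOn_right) := by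
  have e : ∀ (x : μ₀.support) (y : μ₁.support),
      (density (kernel μ₀ μ₁ ε A) (restrictDiv ε h.continuous_left.continuousOn)
          (restrictDiv ε h.continuous_right.continuousOn) *
        (liftL (restrictDiv ε hC.continuousOn_left) + liftR (restrictDiv ε hC.continuousOn_right) -
          kernelLin μ₀ μ₁ ε C) : C(μ₀.support × μ₁.support, ℝ)) (x, y) =
      ε⁻¹ * ((h₀ x + h₁ y - 32 * bil C x y) * gibbs ε A φ₀ φ₁ x y) := fun x y => by
    rw [ContinuousMap.mul_apply, density_kernel_apply rfl rfl]
    simp only [ContinuousMap.sub_apply, ContinuousMap.add_apply, pull_apply, restrictDiv_apply,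
      kernelLin_apply, ContinuousMap.fst_apply, ContinuousMap.snd_apply]
    ring
  constructor
  · ext x
    rw [pintL_apply]
    simp only [e]
    rw [integral_const_mul, integral_supportMeasure μ₁ fun y =>
      (h₀ x + h₁ y - 32 * bil C x y) * gibbs ε A φ₀ φ₁ x y, hC.integral_left x x.2, mul_zero]
    rfl
  · ext y
    rw [pintR_apply]
    simp only [e]
    rw [integral_const_mul, integral_supportMeasure μ₀ fun x =>
      (h₀ x + h₁ y - 32 * bil C x y) * gibbs ε A φ₀ φ₁ x y, hC.integral_right y y.2, mul_zero]
    rfl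

lemma IsLinSol.exists_solvesLinearized (hε : 0 < ε) (h : IsEOTPotentials μ₀ μ₁ ε A φ₀ φ₁)
    {C : Mat d₀ d₁} {a : C(μ₀.support, ℝ)} {b : C(μ₁.support, ℝ)}
    (hab : IsLinSol (supportMeasure μ₀) (supportMeasure μ₁)
      (density (kernel μ₀ μ₁ ε A) (restrictDiv ε h.continuous_left.continuousOn)
        (restrictDiv ε h.continuous_right.continuousOn)) (kernelLin μ₀ μ₁ ε C) a b) :
    ∃ h₀ h₁, SolvesLinearized μ₀ μ₁ ε A φ₀ φ₁ C h₀ h₁ := by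
  -- Extension by zero is enough, as continuity and the equations are required on the supports only.
  set h₀ : E d₀ → ℝ := Function.extend Subtype.val (fun x => ε * a x) 0
  set h₁ : E d₁ → ℝ := Function.extend Subtype.val (fun y => ε * b y) 0
  have e0 : ∀ x : μ₀.support, h₀ x = ε * a x := Subtype.val_injective.extend_apply _ _
  have e1 : ∀ y : μ₁.support, h₁ y = ε * b y := Subtype.val_injective.extend_apply _ _
  have e : ∀ (x : μ₀.support) (y : μ₁.support),
      (h₀ x + h₁ y - 32 * bil C x y) * gibbs ε A φ₀ φ₁ x y =
      ε * (density (kernel μ₀ μ₁ ε A) (restrictDiv ε h.continuous_left.continuousOn)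
        (restrictDiv ε h.continuous_right.continuousOn) *
        (liftL a + liftR b - kernelLin μ₀ μ₁ ε C) : C(μ₀.support × μ₁.support, ℝ)) (x, y) := fun x y => by
    rw [ContinuousMap.mul_apply, density_kernel_apply rfl rfl, e0, e1]
    simp only [ContinuousMap.sub_apply, ContinuousMap.add_apply, pull_apply,
      kernelLin_apply, ContinuousMap.fst_apply, ContinuousMap.snd_apply]
    field_simp
  refine ⟨h₀, h₁, ?_, ?_, fun x hx => ?_, fun y hy => ?_⟩
  · rw [continuousOn_iff_continuous_domRestrict]
    exact (a.continuous.const_mul ε).congr fun x => (e0 x).symm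
  · rw [continuousOn_iff_continuous_domRestrict]
    exact (b.continuous.const_mul ε).congr fun y => (e1 y).symm
  · rw [← integral_supportMeasure]
    have h1 := DFunLike.congr_fun hab.left ⟨x, hx⟩
    rw [pintL_apply] at h1
    simp only [e ⟨x, hx⟩]
    rw [integral_const_mul, h1]
    exact mul_zero ε
  · rw [← integral_supportMeasure]
    have h1 := DFunLike.congr_fun hab.right ⟨y, hy⟩
    rw [pintR_apply] at h1
    simp only [fun x => e x ⟨y, hy⟩]
    rw [integral_const_mul, h1]
    exact mul_zero ε

lemma IsEOTPotentials.integral_gibbsMeasure (h : IsEOTPotentials μ₀ μ₁ ε A φ₀ φ₁)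
    {F : E d₀ × E d₁ → ℝ} {f : C(μ₀.support × μ₁.support, ℝ)}
    (hF : ∀ z : μ₀.support × μ₁.support, F (z.1, z.2) = f z) :
    ∫ z, F z ∂gibbsMeasure μ₀ μ₁ ε A φ₀ φ₁ =
      mean ((supportMeasure μ₀).prod (supportMeasure μ₁))
        (density (kernel μ₀ μ₁ ε A) (restrictDiv ε h.continuous_left.continuousOn)
          (restrictDiv ε h.continuous_right.continuousOn) * f) := by
  rw [gibbsMeasure, integral_tilted, h.integral_exp_logGibbs (isCompact_iff_compactSpace.2 ‹_›)
    (isCompact_iff_compactSpace.2 ‹_›)]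
  conv_lhs => rw [← map_supportMeasure μ₀, ← map_supportMeasure μ₁,
    Measure.map_prod_map _ _ measurable_subtype_coe measurable_subtype_coe]
  rw [((measurableEmbedding_support μ₀).prodMap (measurableEmbedding_support μ₁)).integral_map,
    mean_apply]
  refine integral_congr_ae (Eventually.of_forall fun z => ?_)
  rw [ContinuousMap.mul_apply, density_kernel_apply rfl rfl, ← hF]
  simp only [div_one]
  rfl

/-- Near a parameter with given EOT potentials, the optimal value is given by a smooth branch of
solutions. -/
theorem IsEOTPotentials.exists_branch (hε : 0 < ε) (h : IsEOTPotentials μ₀ μ₁ ε A φ₀ φ₁) :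
    ∃ Ψ : Mat d₀ d₁ → C(μ₀.support, ℝ) × C(μ₁.support, ℝ), ContDiffAt ℝ 2 Ψ A ∧
      Ψ A = (restrictDiv ε h.continuous_left.continuousOn,
        restrictDiv ε h.continuous_right.continuousOn) ∧
      (∀ᶠ A' in 𝓝 A, IsSol (supportMeasure μ₀) (supportMeasure μ₁)
        (kernelConst μ₀ μ₁ ε + kernelLin μ₀ μ₁ ε A') (Ψ A').1 (Ψ A').2) ∧
      OT μ₀ μ₁ ε =ᶠ[𝓝 A] fun A' =>
        ε • meanAdd (supportMeasure μ₀) (supportMeasure μ₁) (Ψ A') := by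
  obtain ⟨Ψ, h1, h2, h3⟩ := EGW.exists_branch (supportMeasure μ₀) (supportMeasure μ₁) h.isSol
  refine ⟨Ψ, h1, h2, h3, ?_⟩
  filter_upwards [h3] with A' hA'
  obtain ⟨ψ₀, ψ₁, hψ, hu, hv⟩ := IsSol.exists_isEOTPotentials hε hA'
  rw [hψ.OT_eq hε (isCompact_iff_compactSpace.2 ‹_›) (isCompact_iff_compactSpace.2 ‹_›),
    meanAdd_apply, smul_eq_mul, mul_add, mean_apply, mean_apply, ← integral_const_mul,
    ← integral_const_mul, ← integral_supportMeasure μ₀, ← integral_supportMeasure μ₁]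
  congr 1
  · refine integral_congr_ae (Eventually.of_forall fun x => ?_)
    simp only [hu]
    field_simp
  · refine integral_congr_ae (Eventually.of_forall fun x => ?_)
    simp only [hv]
    field_simp

/-- The branch depends on the base point, but every branch computes the same function `OT`, so local
smoothness suffices. -/
theorem contDiff_OT (μ₀ : Measure (E d₀)) (μ₁ : Measure (E d₁))
    [CompactSpace μ₀.support] [CompactSpace μ₁.support]
    [IsProbabilityMeasure μ₀] [IsProbabilityMeasure μ₁] (hε : 0 < ε) :
    ContDiff ℝ 2 (OT μ₀ μ₁ ε) := by
  refine contDiff_iff_contDiffAt.2 fun A => ?_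
  obtain ⟨φ₀, φ₁, h⟩ := exists_isEOTPotentials μ₀ μ₁ hε A
  obtain ⟨Ψ, h1, -, -, h4⟩ := h.exists_branch hε
  refine ContDiffAt.congr_of_eventuallyEq ?_ h4
  exact ((meanAdd (supportMeasure μ₀) (supportMeasure μ₁)).contDiff.contDiffAt.comp A h1).const_smul
    ε

theorem IsEOTPotentials.exists_solvesLinearized (hε : 0 < ε)
    (h : IsEOTPotentials μ₀ μ₁ ε A φ₀ φ₁) (C : Mat d₀ d₁) :
    ∃ h₀ h₁, SolvesLinearized μ₀ μ₁ ε A φ₀ φ₁ C h₀ h₁ := by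
  obtain ⟨Ψ, h1, h2, h3, -⟩ := h.exists_branch hε
  have := isLinSol_of_branch (supportMeasure μ₀) (supportMeasure μ₁)
    (h1.differentiableAt two_ne_zero) h3 C
  rw [h2] at this
  exact this.exists_solvesLinearized hε h

/-- The functions h and the kernel are both divided by ε, whence ε⁻²; the factor ε in front of
`meanAdd` later reduces it to ε⁻¹. -/
lemma mean_mul_restrictDiv_eq (h : IsEOTPotentials μ₀ μ₁ ε A φ₀ φ₁) {C : Mat d₀ d₁}
    {h₀ : E d₀ → ℝ} {h₁ : E d₁ → ℝ} (hC : SolvesLinearized μ₀ μ₁ ε A φ₀ φ₁ C h₀ h₁) :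
    mean ((supportMeasure μ₀).prod (supportMeasure μ₁))
      (density (kernel μ₀ μ₁ ε A) (restrictDiv ε h.continuous_left.continuousOn)
          (restrictDiv ε h.continuous_right.continuousOn) *
        ((liftL (restrictDiv ε hC.continuousOn_left) +
          liftR (restrictDiv ε hC.continuousOn_right)) ^ 2 - kernelLin μ₀ μ₁ ε C ^ 2)) =
    (ε⁻¹) ^ 2 * ∫ z, ((h₀ z.1 + h₁ z.2) ^ 2 - 32 ^ 2 * (bil C z.1 z.2) ^ 2)
      ∂gibbsMeasure μ₀ μ₁ ε A φ₀ φ₁ := by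
  rw [← integral_const_mul, ← h.integral_gibbsMeasure]
  intro z
  simp only [ContinuousMap.sub_apply, ContinuousMap.pow_apply, ContinuousMap.add_apply, pull_apply,
    restrictDiv_apply, kernelLin_apply, ContinuousMap.fst_apply, ContinuousMap.snd_apply]
  ring

theorem fderiv_fderiv_OT (hε : 0 < ε) (h : IsEOTPotentials μ₀ μ₁ ε A φ₀ φ₁) {C : Mat d₀ d₁}
    {h₀ : E d₀ → ℝ} {h₁ : E d₁ → ℝ} (hC : SolvesLinearized μ₀ μ₁ ε A φ₀ φ₁ C h₀ h₁) :
    fderiv ℝ (fderiv ℝ (OT μ₀ μ₁ ε)) A C C =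
      ε⁻¹ * ∫ z, ((h₀ z.1 + h₁ z.2) ^ 2 - 32 ^ 2 * (bil C z.1 z.2) ^ 2)
        ∂gibbsMeasure μ₀ μ₁ ε A φ₀ φ₁ := by
  obtain ⟨Ψ, h1, h2, h3, h4⟩ := h.exists_branch hε
  set W : Mat d₀ d₁ → ℝ := fun A' => meanAdd (supportMeasure μ₀) (supportMeasure μ₁) (Ψ A')
  have hW : ContDiffAt ℝ 2 W A :=
    (meanAdd (supportMeasure μ₀) (supportMeasure μ₁)).contDiff.contDiffAt.comp A h1
  have e1 : fderiv ℝ (OT μ₀ μ₁ ε) =ᶠ[𝓝 A] fun A' => ε • fderiv ℝ W A' := by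
    filter_upwards [h4.eventually_nhds, hW.eventually (by simp)] with A' hA' hWA'
    rw [EventuallyEq.fderiv_eq hA']
    exact fderiv_const_smul (hWA'.differentiableAt two_ne_zero) ε
  have e2 : DifferentiableAt ℝ (fderiv ℝ W) A :=
    (hW.fderiv_right (m := 1) (by norm_num)).differentiableAt one_ne_zero
  have hl := hC.isLinSol h
  have e3 := fderiv_fderiv_meanAdd_branch (supportMeasure μ₀) (supportMeasure μ₁) h1 h3 (C := C)
    (a := restrictDiv ε hC.continuousOn_left) (b := restrictDiv ε hC.continuousOn_right)
    (by rw [h2]; exact hl)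
  rw [h2] at e3
  rw [e1.fderiv_eq, fderiv_fun_const_smul e2]
  simp only [smul_apply, smul_eq_mul]
  refine (congrArg (ε * ·) (e3.trans (mean_mul_restrictDiv_eq h hC))).trans ?_
  field_simp

lemma integral_sq_sub_nonpos (hε : 0 < ε) (h : IsEOTPotentials μ₀ μ₁ ε A φ₀ φ₁) {C : Mat d₀ d₁}
    {h₀ : E d₀ → ℝ} {h₁ : E d₁ → ℝ} (hC : SolvesLinearized μ₀ μ₁ ε A φ₀ φ₁ C h₀ h₁) :
    ∫ z, ((h₀ z.1 + h₁ z.2) ^ 2 - 32 ^ 2 * (bil C z.1 z.2) ^ 2)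
        ∂gibbsMeasure μ₀ μ₁ ε A φ₀ φ₁ ≤ 0 := by
  have h1 := (hC.isLinSol h).mean_sq_sub_nonpos fun z => (density_pos _ _ _ z).le
  rw [mean_mul_restrictDiv_eq h hC] at h1
  have : 0 < (ε⁻¹) ^ 2 := by positivity
  exact nonpos_of_mul_nonpos_right h1 this

lemma neg_variance_le_integral_sq_sub (hε : 0 < ε) (h : IsEOTPotentials μ₀ μ₁ ε A φ₀ φ₁)
    {C : Mat d₀ d₁} {h₀ : E d₀ → ℝ} {h₁ : E d₁ → ℝ}
    (hC : SolvesLinearized μ₀ μ₁ ε A φ₀ φ₁ C h₀ h₁) :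
    -(32 ^ 2 * ProbabilityTheory.variance (fun z => bil C z.1 z.2)
      (gibbsMeasure μ₀ μ₁ ε A φ₀ φ₁)) ≤
      ∫ z, ((h₀ z.1 + h₁ z.2) ^ 2 - 32 ^ 2 * (bil C z.1 z.2) ^ 2)
        ∂gibbsMeasure μ₀ μ₁ ε A φ₀ φ₁ := by
  have k0 : IsCompact μ₀.support := isCompact_iff_compactSpace.2 ‹_›
  have k1 : IsCompact μ₁.support := isCompact_iff_compactSpace.2 ‹_›
  have hγ := h.isCoupling_gibbsMeasure k0 k1
  have := hγ.isProbabilityMeasure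
  have hmem : MemLp (fun z : E d₀ × E d₁ => bil C z.1 z.2) 2 (gibbsMeasure μ₀ μ₁ ε A φ₀ φ₁) :=
    (memLp_two_iff_integrable_sq (continuous_bil C).aestronglyMeasurable).2
      (hγ.integrable k0 k1 ((continuous_bil C).pow 2))
  have h1 := (hC.isLinSol h).le_mean_sq_sub (fun z => (density_pos _ _ _ z).le) h.isSol.mean_density
  have e1 := h.integral_gibbsMeasure (F := fun z => 32 * bil C z.1 z.2 / ε)
    (f := kernelLin μ₀ μ₁ ε C) fun z => rfl
  have e2 := h.integral_gibbsMeasure (F := fun z => (32 * bil C z.1 z.2 / ε) ^ 2)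
    (f := kernelLin μ₀ μ₁ ε C ^ 2) fun z => rfl
  rw [mean_mul_restrictDiv_eq h hC, ← e1, ← e2] at h1
  have e3 : ∫ z, 32 * bil C z.1 z.2 / ε ∂gibbsMeasure μ₀ μ₁ ε A φ₀ φ₁ =
      32 * ε⁻¹ * ∫ z, bil C z.1 z.2 ∂gibbsMeasure μ₀ μ₁ ε A φ₀ φ₁ := by
    rw [← integral_const_mul]
    exact integral_congr_ae (Eventually.of_forall fun z => by ring)
  have e4 : ∫ z, (32 * bil C z.1 z.2 / ε) ^ 2 ∂gibbsMeasure μ₀ μ₁ ε A φ₀ φ₁ =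
      (32 * ε⁻¹) ^ 2 * ∫ z, bil C z.1 z.2 ^ 2 ∂gibbsMeasure μ₀ μ₁ ε A φ₀ φ₁ := by
    rw [← integral_const_mul]
    exact integral_congr_ae (Eventually.of_forall fun z => by ring)
  rw [ProbabilityTheory.variance_eq_sub hmem]
  rw [e3, e4] at h1
  have hp : 0 < (ε⁻¹) ^ 2 := by positivity
  refine le_of_mul_le_mul_left (le_trans (le_of_eq ?_) h1) hp
  simp only [Pi.pow_apply]
  ring

end EGW

end Transfer

/-! ### The Hessian of Φ and the moment bound. -/

noncomputable section Conclusion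

namespace EGW

open Filter Topology
open scoped Matrix

variable {d₀ d₁ : ℕ}

lemma isSymm_hessian {F : Mat d₀ d₁ → ℝ} (hF : ContDiff ℝ 2 F) (A : Mat d₀ d₁) :
    (hessian F A).IsSymm := by
  ext p q
  exact (hF.contDiffAt.isSymmSndFDerivAt (by simp)).eq _ _

lemma dotProduct_hessian_mulVec (F : Mat d₀ d₁ → ℝ) (A C : Mat d₀ d₁) :
    C.ofLp ⬝ᵥ hessian F A *ᵥ C.ofLp = fderiv ℝ (fderiv ℝ F) A C C := by
  have hs : ∀ D : Mat d₀ d₁, D = ∑ p, D p • EuclideanSpace.single p (1 : ℝ) := fun D => by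
    have := (EuclideanSpace.basisFun (Fin d₀ × Fin d₁) ℝ).sum_repr D
    simpa using this.symm
  have h : ∀ D D' : Mat d₀ d₁, fderiv ℝ (fderiv ℝ F) A D D' =
      ∑ p, D p * ∑ q, fderiv ℝ (fderiv ℝ F) A (EuclideanSpace.single p 1)
        (EuclideanSpace.single q 1) * D' q := fun D D' => by
    conv_lhs => rw [hs D, hs D']
    simp only [map_sum, map_smul, _root_.sum_apply, _root_.smul_apply, smul_eq_mul, Finset.mul_sum]
    rw [Finset.sum_comm]
    refine Finset.sum_congr rfl fun p _ => Finset.sum_congr rfl fun q _ => ?_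
    ring
  rw [h]
  rfl

lemma abs_bil_le (C : Mat d₀ d₁) (x : E d₀) (y : E d₁) : |bil C x y| ≤ ‖C‖ * (‖x‖ * ‖y‖) := by
  have h1 := Finset.sum_mul_sq_le_sq_mul_sq Finset.univ (fun p : Fin d₀ × Fin d₁ => C p)
    (fun p => x p.1 * y p.2)
  have e1 : bil C x y = ∑ p : Fin d₀ × Fin d₁, C p * (x p.1 * y p.2) := by
    rw [bil, Fintype.sum_prod_type]
    refine Finset.sum_congr rfl fun i _ => Finset.sum_congr rfl fun j _ => ?_
    ring
  have e2 : ∑ p : Fin d₀ × Fin d₁, (x p.1 * y p.2) ^ 2 = ‖x‖ ^ 2 * ‖y‖ ^ 2 := by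
    rw [EuclideanSpace.real_norm_sq_eq, EuclideanSpace.real_norm_sq_eq, Finset.sum_mul_sum,
      Fintype.sum_prod_type]
    simp only [mul_pow]
  rw [← e1, e2, ← EuclideanSpace.real_norm_sq_eq, ← mul_pow, ← mul_pow] at h1
  exact abs_le_of_sq_le_sq h1 (by positivity)

variable {μ₀ : Measure (E d₀)} {μ₁ : Measure (E d₁)} {ε : ℝ}

/-- The variance is at most the second moment. Cauchy–Schwarz is then used twice: for the Frobenius
product, giving ‖x‖²‖y‖², and for the integral of that product. -/
lemma IsCoupling.variance_bil_le [IsProbabilityMeasure μ₀] (hμ₀ : IsCompact μ₀.support)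
    (hμ₁ : IsCompact μ₁.support) {π : Measure (E d₀ × E d₁)} (hπ : IsCoupling μ₀ μ₁ π)
    {C : Mat d₀ d₁} (hC : ‖C‖ = 1) :
    ProbabilityTheory.variance (fun z => bil C z.1 z.2) π ≤ √(moment 4 μ₀ * moment 4 μ₁) := by
  have := hπ.isProbabilityMeasure
  have c0 : Continuous fun z : E d₀ × E d₁ => ‖z.1‖ ^ 2 := by fun_prop
  have c1 : Continuous fun z : E d₀ × E d₁ => ‖z.2‖ ^ 2 := by fun_prop
  have h1 : ProbabilityTheory.variance (fun z => bil C z.1 z.2) π ≤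
      ∫ z, bil C z.1 z.2 ^ 2 ∂π :=
    ProbabilityTheory.variance_le_expectation_sq (continuous_bil C).aestronglyMeasurable
  have h2 : ∫ z, bil C z.1 z.2 ^ 2 ∂π ≤ ∫ z, ‖z.1‖ ^ 2 * ‖z.2‖ ^ 2 ∂π := by
    refine integral_mono (hπ.integrable hμ₀ hμ₁ ((continuous_bil C).pow 2))
      (hπ.integrable hμ₀ hμ₁ (c0.mul c1)) fun z => ?_
    have := abs_bil_le C z.1 z.2
    rw [hC, one_mul] at this
    simp only
    rw [← mul_pow]
    exact sq_le_sq.2 (this.trans (le_abs_self _))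
  have h3 := integral_mul_le_Lp_mul_Lq_of_nonneg (μ := π) Real.HolderConjugate.two_two
    (f := fun z => ‖z.1‖ ^ 2) (g := fun z => ‖z.2‖ ^ 2)
    (Eventually.of_forall fun z => sq_nonneg _) (Eventually.of_forall fun z => sq_nonneg _)
    (by
      rw [ENNReal.ofReal_ofNat]
      exact (memLp_two_iff_integrable_sq c0.aestronglyMeasurable).2
        (hπ.integrable hμ₀ hμ₁ (c0.pow 2)))
    (by
      rw [ENNReal.ofReal_ofNat]
      exact (memLp_two_iff_integrable_sq c1.aestronglyMeasurable).2
        (hπ.integrable hμ₀ hμ₁ (c1.pow 2)))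
  have e0 : ∫ z, (‖z.1‖ ^ 2) ^ (2 : ℝ) ∂π = moment 4 μ₀ := by
    rw [moment, ← hπ.1, integral_map measurable_fst.aemeasurable
      (by exact (continuous_norm.pow 4).aestronglyMeasurable)]
    refine integral_congr_ae (Eventually.of_forall fun z => ?_)
    simp only [Real.rpow_two, ← pow_mul]
  have e1 : ∫ z, (‖z.2‖ ^ 2) ^ (2 : ℝ) ∂π = moment 4 μ₁ := by
    rw [moment, ← hπ.2, integral_map measurable_snd.aemeasurable
      (by exact (continuous_norm.pow 4).aestronglyMeasurable)]
    refine integral_congr_ae (Eventually.of_forall fun z => ?_)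
    simp only [Real.rpow_two, ← pow_mul]
  rw [e0, e1, ← Real.sqrt_eq_rpow, ← Real.sqrt_eq_rpow, ← Real.sqrt_mul] at h3
  · exact h1.trans (h2.trans h3)
  · exact integral_nonneg fun x => by positivity

variable [CompactSpace μ₀.support] [CompactSpace μ₁.support] [IsProbabilityMeasure μ₀]
  [IsProbabilityMeasure μ₁]

lemma contDiff_Phi (hε : 0 < ε) : ContDiff ℝ 2 (Phi μ₀ μ₁ ε) :=
  (contDiff_const.mul (contDiff_norm_sq ℝ)).add (contDiff_OT μ₀ μ₁ hε)

lemma fderiv_fderiv_Phi (hε : 0 < ε) (A C : Mat d₀ d₁) :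
    fderiv ℝ (fderiv ℝ (Phi μ₀ μ₁ ε)) A C C =
      64 * ‖C‖ ^ 2 + fderiv ℝ (fderiv ℝ (OT μ₀ μ₁ ε)) A C C := by
  have hOT := contDiff_OT μ₀ μ₁ hε
  have e1 : fderiv ℝ (Phi μ₀ μ₁ ε) =
      fun A => (64 : ℝ) • innerSL ℝ A + fderiv ℝ (OT μ₀ μ₁ ε) A := by
    funext A
    have h1 : HasFDerivAt (fun A : Mat d₀ d₁ => 32 * ‖A‖ ^ 2) ((64 : ℝ) • innerSL ℝ A) A := by
      refine ((hasStrictFDerivAt_norm_sq A).hasFDerivAt.const_mul 32).congr_fderiv ?_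
      ext D
      simp
      ring
    exact (h1.add (hOT.differentiable two_ne_zero A).hasFDerivAt).fderiv
  have h2 : HasFDerivAt (fderiv ℝ (OT μ₀ μ₁ ε)) (fderiv ℝ (fderiv ℝ (OT μ₀ μ₁ ε)) A) A :=
    ((hOT.fderiv_right (m := 1) (by norm_num)).differentiable one_ne_zero A).hasFDerivAt
  have h3 : HasFDerivAt (fun A : Mat d₀ d₁ => (64 : ℝ) • innerSL ℝ A) ((64 : ℝ) • innerSL ℝ) A :=
    ((64 : ℝ) • innerSL ℝ).hasFDerivAt
  have h4 : HasFDerivAt (fun A => (64 : ℝ) • innerSL ℝ A + fderiv ℝ (OT μ₀ μ₁ ε) A) _ A := h3.add h2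
  rw [e1, h4.fderiv]
  simp only [_root_.add_apply, _root_.smul_apply, smul_eq_mul]
  exact congrArg (64 * · + _) (real_inner_self_eq_norm_sq C)

/-- The quadratic form of the Hessian of `Φ` on the unit sphere. -/
lemma dotProduct_hessian_Phi (hε : 0 < ε) {A : Mat d₀ d₁} {φ₀ : E d₀ → ℝ} {φ₁ : E d₁ → ℝ}
    (h : IsEOTPotentials μ₀ μ₁ ε A φ₀ φ₁) {C : Mat d₀ d₁} (hC1 : ‖C‖ = 1)
    {h₀ : E d₀ → ℝ} {h₁ : E d₁ → ℝ} (hC : SolvesLinearized μ₀ μ₁ ε A φ₀ φ₁ C h₀ h₁) :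
    C.ofLp ⬝ᵥ hessian (Phi μ₀ μ₁ ε) A *ᵥ C.ofLp =
      64 + ε⁻¹ * ∫ z, ((h₀ z.1 + h₁ z.2) ^ 2 - 32 ^ 2 * (bil C z.1 z.2) ^ 2)
        ∂gibbsMeasure μ₀ μ₁ ε A φ₀ φ₁ := by
  rw [dotProduct_hessian_mulVec, fderiv_fderiv_Phi hε, fderiv_fderiv_OT hε h hC, hC1]
  norm_num

end EGW

end Conclusion

theorem corollary2 {d₀ d₁ : ℕ} (hd₀ : 0 < d₀) (hd₁ : 0 < d₁)
    (μ₀ : Measure (EGW.E d₀)) (μ₁ : Measure (EGW.E d₁))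
    [IsProbabilityMeasure μ₀] [IsProbabilityMeasure μ₁]
    (hμ₀ : IsCompact μ₀.support) (hμ₁ : IsCompact μ₁.support)
    (ε : ℝ) (hε : 0 < ε) (A : EGW.Mat d₀ d₁) :
    -- the objects in the two items are well defined
    ContDiff ℝ 2 (EGW.Phi μ₀ μ₁ ε) ∧
    (∃! π, EGW.IsEOTCoupling μ₀ μ₁ ε A π) ∧
    (∃ φ₀ φ₁, EGW.IsEOTPotentials μ₀ μ₁ ε A φ₀ φ₁) ∧
    (∀ φ₀ φ₁, EGW.IsEOTPotentials μ₀ μ₁ ε A φ₀ φ₁ →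
      ∀ C, ∃ h₀ h₁, EGW.SolvesLinearized μ₀ μ₁ ε A φ₀ φ₁ C h₀ h₁) ∧
    -- (i) the minimal eigenvalue
    (∀ π, EGW.IsEOTCoupling μ₀ μ₁ ε A π →
      ∀ φ₀ φ₁, EGW.IsEOTPotentials μ₀ μ₁ ε A φ₀ φ₁ →
      ∀ (h₀ : EGW.Mat d₀ d₁ → EGW.E d₀ → ℝ) (h₁ : EGW.Mat d₀ d₁ → EGW.E d₁ → ℝ),
      (∀ C, EGW.SolvesLinearized μ₀ μ₁ ε A φ₀ φ₁ C (h₀ C) (h₁ C)) →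
      ∃ lmin m v : ℝ,
        IsLeast (EGW.eigenvalueSet (EGW.hessian (EGW.Phi μ₀ μ₁ ε) A)) lmin ∧
        IsGLB ((fun C => ∫ z, ((h₀ C z.1 + h₁ C z.2) ^ 2
          - 32 ^ 2 * (EGW.bil C z.1 z.2) ^ 2) ∂π) '' {C : EGW.Mat d₀ d₁ | ‖C‖ = 1}) m ∧
        IsLUB ((fun C => ProbabilityTheory.variance (fun z => EGW.bil C z.1 z.2) π) ''
          {C : EGW.Mat d₀ d₁ | ‖C‖ = 1}) v ∧
        lmin = 64 + ε⁻¹ * m ∧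
        64 + ε⁻¹ * m ≥ 64 - 32 ^ 2 * ε⁻¹ * v ∧
        v ≤ √(EGW.moment 4 μ₀ * EGW.moment 4 μ₁)) ∧
    -- (ii) the maximal eigenvalue
    (∃ lmax : ℝ,
      IsGreatest (EGW.eigenvalueSet (EGW.hessian (EGW.Phi μ₀ μ₁ ε) A)) lmax ∧ lmax ≤ 64) := by
  have : CompactSpace μ₀.support := isCompact_iff_compactSpace.1 hμ₀
  have : CompactSpace μ₁.support := isCompact_iff_compactSpace.1 hμ₁
  have : Nonempty (Fin d₀ × Fin d₁) := ⟨(⟨0, hd₀⟩, ⟨0, hd₁⟩)⟩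
  have hε' : 0 < ε⁻¹ := inv_pos.2 hε
  obtain ⟨ψ₀, ψ₁, hψ⟩ := EGW.exists_isEOTPotentials μ₀ μ₁ hε A
  have hsymm := EGW.isSymm_hessian (EGW.contDiff_Phi (μ₀ := μ₀) (μ₁ := μ₁) hε) A
  refine ⟨EGW.contDiff_Phi hε, ⟨_, hψ.isEOTCoupling_gibbsMeasure hε hμ₀ hμ₁, fun π hπ =>
    hψ.eq_gibbsMeasure hε hμ₀ hμ₁ hπ⟩, ⟨ψ₀, ψ₁, hψ⟩, fun φ₀ φ₁ hφ C =>
    hφ.exists_solvesLinearized hε C, ?_, ?_⟩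
  · intro π hπ φ₀ φ₁ hφ h₀ h₁ hh
    obtain rfl := hφ.eq_gibbsMeasure hε hμ₀ hμ₁ hπ
    obtain ⟨C, hC, hmin, hleast⟩ := EGW.exists_hasEigenvalue_of_isMinOn_sphere hsymm
    have hQ := fun (D : EGW.Mat d₀ d₁) (hD : ‖D‖ = 1) =>
      EGW.dotProduct_hessian_Phi hε hφ hD (hh D)
    have hbdd : ∀ v ∈ (fun C => ProbabilityTheory.variance (fun z => EGW.bil C z.1 z.2)
        (EGW.gibbsMeasure μ₀ μ₁ ε A φ₀ φ₁)) '' {C : EGW.Mat d₀ d₁ | ‖C‖ = 1},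
        v ≤ √(EGW.moment 4 μ₀ * EGW.moment 4 μ₁) := by
      rintro _ ⟨D, hD, rfl⟩
      exact hπ.1.variance_bil_le hμ₀ hμ₁ hD
    have hlub := isLUB_csSup (Set.Nonempty.image _ ⟨C, hC⟩) ⟨_, hbdd⟩
    -- On the sphere the quadratic form is an increasing affine function of the integral, so the
    -- minimizer C also attains the infimum m.
    refine ⟨_, _, _, hleast, IsLeast.isGLB ⟨⟨C, hC, rfl⟩, ?_⟩, hlub, hQ C hC, ?_, hlub.2 hbdd⟩
    · rintro _ ⟨D, hD, rfl⟩
      have := hmin D hD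
      rw [hQ C hC, hQ D hD] at this
      exact le_of_mul_le_mul_left (le_of_add_le_add_left this) hε'
    -- The variance bound is needed only at the minimizer C, whose variance is at most the supremum.
    · have h1 := EGW.neg_variance_le_integral_sq_sub hε hφ (hh C)
      have h2 := hlub.1 ⟨C, hC, rfl⟩
      have h3 := mul_le_mul_of_nonneg_left h1 hε'.le
      have h4 := mul_le_mul_of_nonneg_left h2 hε'.le
      simp only at h3 h4 ⊢
      linarith
  · obtain ⟨C, hC, hgreatest⟩ := EGW.exists_hasEigenvalue_of_isMaxOn_sphere hsymm
    obtain ⟨h₀, h₁, hh⟩ := hψ.exists_solvesLinearized hε C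
    refine ⟨_, hgreatest, ?_⟩
    rw [EGW.dotProduct_hessian_Phi hε hψ hC hh]
    have := mul_nonpos_of_nonneg_of_nonpos hε'.le (EGW.integral_sq_sub_nonpos hε hψ hh)
    linarith
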